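/- Let $n\ge 1$ and let $(M,H,g,\mathbb Q)$ be a quaternionic contact (qc) manifold of dimension $4n+3$ with a fixed horizontal metric: $H\subset TM$ is a distribution of codimension three, $g$ is a smooth fibre metric on $H$, and $\mathbb Q$ is a bundle of endomorphisms of $H$ such that near each point there are smooth one-forms $\eta_1,\eta_2,\eta_3$ with $H=\bigcap_s\ker\eta_s$ and smooth almost complex structures $I_1,I_2,I_3$ on $H$ spanning $\mathbb Q$ with $I_1I_2=-I_2I_1=I_3$, $I_1I_2I_3=-\mathrm{id}_H$, $g(I_sX,I_sY)=g(X,Y)$ and $2g(I_sX,Y)=d\eta_s(X,Y)$ for $X,Y\in H$, where $d\eta(X,Y)=X\eta(Y)-Y\eta(X)-\eta([X,Y])$. Let $V$ and $\nabla$ be the supplementary distribution and the Biquard connection, with torsion $T(A,B)=\nabla_AB-\nabla_BA-[A,B]$. That is, $TM=H\oplus V$; $\nabla$ preserves $H$, $V$, $g$ and $\mathbb Q$; $T(X,Y)=-[X,Y]_V$ for $X,Y\in H$; for $\xi\in V$, $T(\xi,\cdot)$ restricts to an endomorphism of $H$ which is orthogonal to $sp(n)\oplus sp(1)$, where $sp(1)=\mathbb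 Q$, $sp(n)$ is the space of skew-symmetric endomorphisms of $H$ commuting with $\mathbb Q$, and $\langle A,B\rangle=\sum_a g(Ae_a,Be_a)$; and $\nabla\varphi=0$ for the identification $\varphi:V\to\mathbb Q$, $\varphi(\xi)=\sum_s\eta_s(\xi)I_s$. (If $n=1$, the existence of $V$ and $\nabla$, equivalently of Reeb vector fields, is part of the definition of a qc structure.) Let $\xi_1,\xi_2,\xi_3$ be the Reeb vector fields of $\eta$, i.e. the sections of $V$ with $\eta_s(\xi_k)=\delta_{sk}$, and extend $g$ to $TM$ by making $V\perp H$ and $\xi_1,\xi_2,\xi_3$ orthonormal. For an orthonormal basis $e_1,\dots,e_{4n}$ of $H$ and a smooth function $f$, let $\nabla f\in H$ be the horizontal gradient, $g(\nabla f,X)=df(X)$ for $X\in H$, let $\nabla^2f(A,B)=A(Bf)-(\nabla_AB)f$, $|\nabla^2f|^2=\sum_{a,b}\nabla^2f(e_a,e_b)^2$, and let $\Delta f=-\sum_a\nabla^2f(e_a,e_a)$ be the sub-Laplacian. Let $R(A,B)C=\nabla_A\nabla_BC-\nabla_B\nabla_AC-\nabla_{[A,B]}C$, $Ric(A,B)=\sum_b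 g(R(e_b,A)B,e_b)$ and $T(A,B,C)=g(T(A,B),C)$. Theorem. For every smooth function $f$ on $M$, $$-\tfrac12\,\Delta|\nabla f|^2=|\nabla^2f|^2-g\big(\nabla(\Delta f),\nabla f\big)+Ric(\nabla f,\nabla f)+2\sum_{s=1}^3T(\xi_s,I_s\nabla f,\nabla f)+4\sum_{s=1}^3\nabla^2f(\xi_s,I_s\nabla f).$$ -/

import Mathlib

open scoped Manifold ContDiff

noncomputable section

namespace QC

/-- The model vector space of a manifold of dimension `4n+3`. -/
abbrev Model (n : ℕ) : Type := EuclideanSpace ℝ (Fin (4 * n + 3))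

/-- The tangent space at `x` of a manifold of dimension `4n+3`. -/
abbrev Tan (n : ℕ) {M : Type*} [TopologicalSpace M] [ChartedSpace (Model n) M] (x : M) : Type :=
  TangentSpace (𝓡 (4 * n + 3)) x

section Calculus

variable {n : ℕ} {M : Type*} [TopologicalSpace M] [ChartedSpace (Model n) M]

/-- Smoothness at `x` of a vector field. -/
def SmoothFieldAt [IsManifold (𝓡 (4 * n + 3)) ∞ M] (X : Π y : M, Tan n y) (x : M) : Prop :=
  ContMDiffAt (𝓡 (4 * n + 3)) ((𝓡 (4 * n + 3)).prod 𝓘(ℝ, Model n)) ∞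
    (fun y ↦ (⟨y, X y⟩ : TangentBundle (𝓡 (4 * n + 3)) M)) x

/-- Smoothness at `x` of a real function. -/
def SmoothFunAt (f : M → ℝ) (x : M) : Prop :=
  ContMDiffAt (𝓡 (4 * n + 3)) 𝓘(ℝ, ℝ) ∞ f x

/-- The differential `df` of a real function. -/
def differential (f : M → ℝ) (x : M) : Tan n x →L[ℝ] ℝ :=
  mvfderiv (𝓡 (4 * n + 3)) f x

/-- The Lie bracket `[X, Y]` of vector fields. -/
def bracket (X Y : Π y : M, Tan n y) (x : M) : Tan n x :=
  VectorField.mlieBracket (𝓡 (4 * n + 3)) X Y x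

/-- The exterior derivative of a one-form, evaluated on vector fields:
`dη(X, Y) = X(η(Y)) - Y(η(X)) - η([X, Y])`. -/
def extDerivOneForm (η : Π y : M, Tan n y →ₗ[ℝ] ℝ) (X Y : Π y : M, Tan n y) (x : M) : ℝ :=
  differential (fun y ↦ η y (Y y)) x (X x) - differential (fun y ↦ η y (X y)) x (Y x) - η x (bracket X Y x)

/-- A vector field with value `v` at `x`, smooth near `x`. The expressions below in which it
occurs are tensorial, so they do not depend on the extension. -/
def extField [IsManifold (𝓡 (4 * n + 3)) ∞ M] {x : M} (v : Tan n x) : Π y : M, Tan n y :=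
  FiberBundle.extend (Model n) (E := (TangentSpace (𝓡 (4 * n + 3)) : M → Type _)) v

end Calculus

/-- The data of a quaternionic contact structure on a manifold of dimension `4n+3`: a distribution
`H`, a bilinear form `g` on `H` and a bundle `Q` of endomorphisms of `H`. -/
structure PreStructure (n : ℕ) (M : Type*) [TopologicalSpace M] [ChartedSpace (Model n) M] where
  /-- the horizontal distribution -/
  H : Π x : M, Submodule ℝ (Tan n x)
  /-- the horizontal metric -/
  g : Π x : M, LinearMap.BilinForm ℝ (H x)
  /-- the bundle of endomorphisms of `H` -/
  Q : Π x : M, Submodule ℝ (Module.End ℝ (H x))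

namespace PreStructure

variable {n : ℕ} {M : Type*} [TopologicalSpace M] [ChartedSpace (Model n) M]

/-- Smoothness at `x` of a horizontal vector field. -/
def SmoothAt [IsManifold (𝓡 (4 * n + 3)) ∞ M] (S : PreStructure n M) (X : Π y : M, S.H y)
    (x : M) : Prop :=
  SmoothFieldAt (fun y ↦ (X y : Tan n y)) x

/-- Smoothness at `x` of a field of endomorphisms of `H`: it takes horizontal fields that are smooth
at `x` to such fields. Smoothness of the metric and of one-forms is expressed likewise below. -/
def SmoothEndAt [IsManifold (𝓡 (4 * n + 3)) ∞ M] (S : PreStructure n M)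
    (σ : Π y : M, Module.End ℝ (S.H y)) (x : M) : Prop :=
  ∀ X : Π y : M, S.H y, S.SmoothAt X x → S.SmoothAt (fun y ↦ σ y (X y)) x

/-- Local data `(η, I)` on an open set `U` (the values outside of `U` are irrelevant): one-forms
`η₁, η₂, η₃` with common kernel `H`, and almost complex structures `I₁, I₂, I₃` on `H` which
generate `Q`, satisfy the identities of the imaginary unit quaternions, are compatible with the
metric, and are related to `η` by `2 g(I_s X, Y) = dη_s(X, Y)` on `H`.
The indices `1, 2, 3` are `0, 1, 2 : Fin 3` here. -/
structure IsFrame [IsManifold (𝓡 (4 * n + 3)) ∞ M] (S : PreStructure n M) (U : Set M)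
    (η : Fin 3 → Π x : M, Tan n x →ₗ[ℝ] ℝ) (I : Fin 3 → Π x : M, Module.End ℝ (S.H x)) :
    Prop where
  isOpen : IsOpen U
  smooth_form : ∀ s, ∀ x ∈ U, ∀ X : Π y : M, Tan n y, SmoothFieldAt X x →
    SmoothFunAt (n := n) (fun y ↦ η s y (X y)) x
  smooth_end : ∀ s, ∀ x ∈ U, S.SmoothEndAt (I s) x
  mem_iff : ∀ x ∈ U, ∀ v : Tan n x, v ∈ S.H x ↔ ∀ s, η s x v = 0
  sq : ∀ x ∈ U, ∀ s, I s x * I s x = -1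
  mul_01 : ∀ x ∈ U, I 0 x * I 1 x = I 2 x
  mul_10 : ∀ x ∈ U, I 1 x * I 0 x = -I 2 x
  mul_012 : ∀ x ∈ U, I 0 x * I 1 x * I 2 x = -1
  hermitian : ∀ x ∈ U, ∀ s, ∀ X Y : S.H x, S.g x (I s x X) (I s x Y) = S.g x X Y
  contact : ∀ x ∈ U, ∀ s, ∀ X Y : Π y : M, S.H y, S.SmoothAt X x → S.SmoothAt Y x →
    2 * S.g x (I s x (X x)) (Y x) =
      extDerivOneForm (η s) (fun y ↦ (X y : Tan n y)) (fun y ↦ (Y y : Tan n y)) x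
  span : ∀ x ∈ U, S.Q x = Submodule.span ℝ (Set.range fun s ↦ I s x)

end PreStructure

/-- A quaternionic contact structure `(H, g, Q)` on a manifold `M` of dimension `4n+3`: `H` has
codimension three, `g` is a smooth fibre metric on `H`, and around each point there are local data
`(η, I)` as in `PreStructure.IsFrame`. -/
structure QCStructure (n : ℕ) (M : Type*) [TopologicalSpace M] [ChartedSpace (Model n) M]
    [IsManifold (𝓡 (4 * n + 3)) ∞ M] extends PreStructure n M where
  finrank_H : ∀ x : M, Module.finrank ℝ (H x) = 4 * n
  g_symm : ∀ (x : M) (X Y : H x), g x X Y = g x Y X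
  g_pos : ∀ (x : M) (X : H x), X ≠ 0 → 0 < g x X X
  g_smooth : ∀ (x : M) (X Y : Π y : M, H y), toPreStructure.SmoothAt X x →
    toPreStructure.SmoothAt Y x → SmoothFunAt (n := n) (fun y ↦ g y (X y) (Y y)) x
  frames : ∀ p : M, ∃ (U : Set M) (η : Fin 3 → Π x : M, Tan n x →ₗ[ℝ] ℝ)
    (I : Fin 3 → Π x : M, Module.End ℝ (H x)), p ∈ U ∧ toPreStructure.IsFrame U η I

namespace QCStructure

variable {n : ℕ} {M : Type*} [TopologicalSpace M] [ChartedSpace (Model n) M]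
  [IsManifold (𝓡 (4 * n + 3)) ∞ M]

theorem exists_orthonormalBasis (S : QCStructure n M) (x : M) :
    ∃ e : Module.Basis (Fin (4 * n)) ℝ (S.H x),
      ∀ a b, S.g x (e a) (e b) = if a = b then 1 else 0 := by
  have hfd : FiniteDimensional ℝ (Tan n x) :=
    inferInstanceAs (FiniteDimensional ℝ (Model n))
  let c : InnerProductSpace.Core ℝ (S.H x) :=
    { inner := fun X Y ↦ S.g x X Y
      conj_inner_symm := fun X Y ↦ by simpa using S.g_symm x Y X
      re_inner_nonneg := fun X ↦ by
        by_cases h : X = 0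
        · simp [h]
        · simpa using (S.g_pos x X h).le
      add_left := fun X Y Z ↦ by simp
      smul_left := fun X Y r ↦ by simp
      definite := fun X h ↦ by
        by_contra h0
        exact (S.g_pos x X h0).ne' h }
  let _ : NormedAddCommGroup (S.H x) := @InnerProductSpace.Core.toNormedAddCommGroup ℝ _ _ _ _ c
  let _ : InnerProductSpace ℝ (S.H x) := InnerProductSpace.ofCore c.toCore
  let b := (stdOrthonormalBasis ℝ (S.H x)).reindex (finCongr (S.finrank_H x))
  refine ⟨b.toBasis, fun i j ↦ ?_⟩
  rw [OrthonormalBasis.coe_toBasis]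
  exact orthonormal_iff_ite.1 b.orthonormal i j

/-- An orthonormal basis `e₁, …, e₄ₙ` of the horizontal space at `x`. -/
def e (S : QCStructure n M) (x : M) : Module.Basis (Fin (4 * n)) ℝ (S.H x) :=
  (S.exists_orthonormalBasis x).choose

theorem nondegenerate (S : QCStructure n M) (x : M) : (S.g x).Nondegenerate := by
  refine ⟨fun X h ↦ ?_, fun X h ↦ ?_⟩ <;>
  · by_contra h0
    exact (S.g_pos x X h0).ne' (h X)

/-- The horizontal gradient `∇f`, defined by `g(∇f, X) = df(X)` for horizontal `X`. -/
def grad (S : QCStructure n M) (f : M → ℝ) (x : M) : S.H x :=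
  haveI : FiniteDimensional ℝ (Tan n x) := inferInstanceAs (FiniteDimensional ℝ (Model n))
  ((S.g x).toDual (S.nondegenerate x)).symm ((differential f x).toLinearMap ∘ₗ (S.H x).subtype)

theorem g_grad (S : QCStructure n M) (f : M → ℝ) (x : M) (X : S.H x) :
    S.g x (S.grad f x) X = differential (n := n) f x X := by
  simp [grad]

/-- The inner product `⟨A, B⟩ = ∑ₐ g(A eₐ, B eₐ)` of endomorphisms of `H`. -/
def endInner (S : QCStructure n M) (x : M) (A B : Module.End ℝ (S.H x)) : ℝ :=
  ∑ a, S.g x (A (S.e x a)) (B (S.e x a))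

/-- The subspace `sp(n)` of `End(H)`: skew-symmetric endomorphisms which commute with `Q`. -/
def spn (S : QCStructure n M) (x : M) : Submodule ℝ (Module.End ℝ (S.H x)) where
  carrier := {A | (∀ X Y, S.g x (A X) Y = -S.g x X (A Y)) ∧ ∀ J ∈ S.Q x, A * J = J * A}
  zero_mem' := by simp
  add_mem' := by
    rintro A B ⟨hA, hA'⟩ ⟨hB, hB'⟩
    refine ⟨fun X Y ↦ ?_, fun J hJ ↦ ?_⟩
    · rw [LinearMap.add_apply, LinearMap.add_apply, map_add, map_add, LinearMap.add_apply,
        hA X Y, hB X Y, neg_add]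
    · rw [add_mul, mul_add, hA' J hJ, hB' J hJ]
  smul_mem' := by
    rintro r A ⟨hA, hA'⟩
    refine ⟨fun X Y ↦ ?_, fun J hJ ↦ ?_⟩
    · rw [LinearMap.smul_apply, LinearMap.smul_apply, map_smul, map_smul, LinearMap.smul_apply,
        hA X Y, smul_neg]
    · rw [smul_mul_assoc, mul_smul_comm, hA' J hJ]

/-- A smooth distribution `V` supplementary to `H`; smoothness says that the horizontal part of a
smooth vector field is smooth. -/
structure Complement (S : QCStructure n M) where
  V : Π x : M, Submodule ℝ (Tan n x)
  isCompl : ∀ x : M, IsCompl (S.H x) (V x)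
  smooth : ∀ (x : M) (X : Π y : M, Tan n y), SmoothFieldAt X x →
    S.SmoothAt (fun y ↦ (S.H y).projectionOnto (V y) (isCompl y) (X y)) x

end QCStructure

/-- Affine connections: covariant derivatives on the tangent bundle. Here `D Y x v` is the
derivative `∇_v Y` at `x` of the vector field `Y` in the direction `v`. -/
abbrev Connection (n : ℕ) (M : Type*) [TopologicalSpace M] [ChartedSpace (Model n) M]
    [IsManifold (𝓡 (4 * n + 3)) ∞ M] : Type _ :=
  CovariantDerivative (𝓡 (4 * n + 3)) (Model n)
    (TangentSpace (𝓡 (4 * n + 3)) : M → Type _)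

namespace Connection

variable {n : ℕ} {M : Type*} [TopologicalSpace M] [ChartedSpace (Model n) M]
  [IsManifold (𝓡 (4 * n + 3)) ∞ M]

/-- The torsion `T(u, v)`, with `T(A, B) = ∇_A B - ∇_B A - [A, B]`. -/
def T (D : Connection n M) (x : M) (u v : Tan n x) : Tan n x :=
  D.torsion x u v

/-- The curvature `R(u, v)w`, with `R(A, B)C = ∇_A ∇_B C - ∇_B ∇_A C - ∇_[A, B] C`. -/
def R (D : Connection n M) (x : M) (u v w : Tan n x) : Tan n x :=
  D (fun y ↦ D (extField w) y (extField v y)) x u - D (fun y ↦ D (extField w) y (extField u y)) x v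
    - D (extField w) x (bracket (extField u) (extField v) x)

/-- The second covariant derivative `∇²f(u, v)`, with `∇²f(A, B) = A(B f) - (∇_A B) f`. -/
def hess (D : Connection n M) (f : M → ℝ) (x : M) (u v : Tan n x) : ℝ :=
  differential (fun y ↦ differential f y (extField v y)) x u - differential f x (D (extField v) x u)

end Connection

namespace QCStructure

variable {n : ℕ} {M : Type*} [TopologicalSpace M] [ChartedSpace (Model n) M]
  [IsManifold (𝓡 (4 * n + 3)) ∞ M]

/-- The horizontal part of a tangent vector, along `V`. -/
def Complement.hor {S : QCStructure n M} (C : S.Complement) (x : M) : Tan n x →ₗ[ℝ] S.H x :=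
  (S.H x).projectionOnto (C.V x) (C.isCompl x)

/-- The vertical part of a tangent vector, along `H`. -/
def Complement.ver {S : QCStructure n M} (C : S.Complement) (x : M) : Tan n x →ₗ[ℝ] C.V x :=
  (C.V x).projectionOnto (S.H x) (C.isCompl x).symm

/-- The endomorphism `T_ξ = T(ξ, ·)` of `H`. -/
def Complement.torsionEnd {S : QCStructure n M} (C : S.Complement) (D : Connection n M) (x : M)
    (ξ : Tan n x) : Module.End ℝ (S.H x) :=
  C.hor x ∘ₗ (D.torsion x ξ).toLinearMap ∘ₗ (S.H x).subtype

/-- The identification of `V` with the subspace `sp(1) = Q` of `End(H)` given by local data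
`(η, I)`, namely `φ(ξ) = ∑_s η_s(ξ) I_s`. It does not depend on the local data. -/
def phi (S : QCStructure n M) (η : Fin 3 → Π x : M, Tan n x →ₗ[ℝ] ℝ)
    (I : Fin 3 → Π x : M, Module.End ℝ (S.H x)) (x : M) (ξ : Tan n x) : Module.End ℝ (S.H x) :=
  ∑ s, η s x ξ • I s x

/-- `V` and `∇` are the supplementary distribution and the Biquard connection of a quaternionic
contact structure. An endomorphism field `σ` of `H` is differentiated by the Leibniz rule
`∇_v (σ X) = (∇_v σ) X + σ (∇_v X)`. -/
structure IsBiquard (S : QCStructure n M) (C : S.Complement) (D : Connection n M) : Prop where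
  /-- `∇` is smooth. -/
  smooth : ∀ U : Set M, IsOpen U → ContMDiffCovariantDerivativeOn (Model n) ∞ D.toFun U
  /-- `∇` preserves `H`. -/
  preserves_H : ∀ (x : M) (X : Π y : M, S.H y), S.SmoothAt X x →
    ∀ v : Tan n x, D (fun y ↦ (X y : Tan n y)) x v ∈ S.H x
  /-- `∇` preserves `V`. -/
  preserves_V : ∀ (x : M) (ξ : Π y : M, C.V y), SmoothFieldAt (fun y ↦ (ξ y : Tan n y)) x →
    ∀ v : Tan n x, D (fun y ↦ (ξ y : Tan n y)) x v ∈ C.V x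
  /-- `∇g = 0`. -/
  metric : ∀ (x : M) (X Y : Π y : M, S.H y), S.SmoothAt X x → S.SmoothAt Y x →
    ∀ v : Tan n x, differential (fun y ↦ S.g y (X y) (Y y)) x v =
      S.g x (C.hor x (D (fun y ↦ (X y : Tan n y)) x v)) (Y x) +
        S.g x (X x) (C.hor x (D (fun y ↦ (Y y : Tan n y)) x v))
  /-- `∇σ ∈ Γ(Q)` for `σ ∈ Γ(Q)`. -/
  quaternionic : ∀ (x : M) (σ : Π y : M, Module.End ℝ (S.H y)), (∀ y, σ y ∈ S.Q y) →
    S.SmoothEndAt σ x → ∀ v : Tan n x, ∃ τ ∈ S.Q x, ∀ X : Π y : M, S.H y, S.SmoothAt X x →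
      C.hor x (D (fun y ↦ (σ y (X y) : Tan n y)) x v) =
        τ (X x) + σ x (C.hor x (D (fun y ↦ (X y : Tan n y)) x v))
  /-- `T(X, Y) = -[X, Y]_V` for horizontal `X` and `Y`. -/
  torsion_H : ∀ (x : M) (X Y : Π y : M, S.H y), S.SmoothAt X x → S.SmoothAt Y x →
    D.T x (X x) (Y x) =
      -(C.ver x (bracket (fun y ↦ (X y : Tan n y)) (fun y ↦ (Y y : Tan n y)) x) : Tan n x)
  /-- For vertical `ξ`, `T(ξ, ·)` maps `H` to `H`. -/
  torsion_V : ∀ (x : M) (ξ : C.V x) (X : S.H x), D.T x ξ X ∈ S.H x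
  /-- For vertical `ξ`, the endomorphism `T(ξ, ·)` of `H` is orthogonal to `sp(n) ⊕ sp(1)`. -/
  torsion_perp : ∀ (x : M) (ξ : C.V x), ∀ A ∈ S.spn x ⊔ S.Q x,
    S.endInner x (C.torsionEnd D x ξ) A = 0
  /-- `∇φ = 0`. -/
  phi_parallel : ∀ (U : Set M) (η : Fin 3 → Π x : M, Tan n x →ₗ[ℝ] ℝ)
    (I : Fin 3 → Π x : M, Module.End ℝ (S.H x)), S.IsFrame U η I → ∀ x ∈ U,
    ∀ (ξ : Π y : M, C.V y) (X : Π y : M, S.H y), SmoothFieldAt (fun y ↦ (ξ y : Tan n y)) x →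
    S.SmoothAt X x → ∀ v : Tan n x,
      C.hor x (D (fun y ↦ (S.phi η I y (ξ y) (X y) : Tan n y)) x v) =
        S.phi η I x (D (fun y ↦ (ξ y : Tan n y)) x v) (X x) +
          S.phi η I x (ξ x) (C.hor x (D (fun y ↦ (X y : Tan n y)) x v))

/-- `ξ₁, ξ₂, ξ₃` are the Reeb vectors at `x` of local data with one-forms `η`: the basis of `V`
dual to `η`. For the distribution `V` of the Biquard connection, the equations
`(ξ_s ⌟ dη_k)|_H = -(ξ_k ⌟ dη_s)|_H` then hold as well: they say that the connection on `V`, which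
is `∇_X ξ = [X, ξ]_V` for horizontal `X` since `T(ξ, X)` is horizontal, is metric. -/
def Complement.IsReebAt {S : QCStructure n M} (C : S.Complement)
    (η : Fin 3 → Π x : M, Tan n x →ₗ[ℝ] ℝ) (x : M) (ξ : Fin 3 → Tan n x) : Prop :=
  (∀ s, ξ s ∈ C.V x) ∧ ∀ s k, η s x (ξ k) = if s = k then 1 else 0

/-- The sub-Laplacian `Δf = -∑ₐ ∇²f(eₐ, eₐ)`. -/
def subLaplacian (S : QCStructure n M) (D : Connection n M) (f : M → ℝ) (x : M) : ℝ :=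
  -∑ a, D.hess f x (S.e x a) (S.e x a)

/-- The squared norm `|∇f|²` of the horizontal gradient. -/
def gradNormSq (S : QCStructure n M) (f : M → ℝ) (x : M) : ℝ :=
  S.g x (S.grad f x) (S.grad f x)

/-- The squared norm `|∇²f|² = ∑ₐ ∑_b ∇²f(eₐ, e_b)²` of the horizontal Hessian. -/
def hessNormSq (S : QCStructure n M) (D : Connection n M) (f : M → ℝ) (x : M) : ℝ :=
  ∑ a, ∑ b, D.hess f x (S.e x a) (S.e x b) ^ 2

/-- The extended metric `g(A, X)` of a tangent vector `A` and a horizontal vector `X`, where the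
extension makes `V` orthogonal to `H`. -/
def Complement.gExt {S : QCStructure n M} (C : S.Complement) (x : M) (A : Tan n x) (X : S.H x) :
    ℝ :=
  S.g x (C.hor x A) X

/-- The qc-Ricci tensor `Ric(A, B) = ∑_b g(R(e_b, A)B, e_b)`. -/
def Complement.Ric {S : QCStructure n M} (C : S.Complement) (D : Connection n M) (x : M)
    (A B : Tan n x) : ℝ :=
  ∑ b, C.gExt x (D.R x (S.e x b) A B) (S.e x b)

end QCStructure

end QC

end

/-! Write Y = ∇f. This is the Bochner argument, with torsion corrections from commuting derivatives.
Since ∇ is metric, ∇²f(A, X) = g(∇_A Y, X) for horizontal X (`hess_eq_g`). Fix p and horizontal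
fields E_a with E_a(p) = e_a and ∇E_a = 0 at p. Such a frame exists because any first-order jet can
be corrected by functions with prescribed differential (`exists_parallel_extension`).
Differentiating |Y|² twice along E_a gives 2 g(∇_{E_a}∇_{E_a}Y, Y) + 2 |∇_{E_a}Y|² at p, and the
second terms sum to 2 |∇²f|².

The first terms must become g(∇_Y ∇_{E_a}Y, E_a), whose sum is -d(Δf)(Y). Let B be parallel at p
with B(p) = Y(p). The Hessian fails to be symmetric by the torsion, so g(∇_{E_a}Y, B) = g(∇_B Y,
E_a) - df(T(E_a, B)) near p. Differentiating along E_a, exchanging the derivatives by the curvature,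
and using [E_a, B] = -T(E_a, B) at p gives g(R(e_a, Y)Y, e_a) - ∇²f(T(e_a, Y), e_a) - ∇²f(e_a,
T(e_a, Y)) as the correction (`g_nab_nab_grad`).

No derivative of the torsion appears, because T is parallel on H (`D_T_eq_zero`): φ(T(X, Z)) = 2 ∑
g(I_s X, Z) I_s, this tensor is parallel since the connection on Q is metric (`exists_skew`), and φ
is parallel and injective on V.

Finally T(X, Z) = 2 ∑ g(I_s X, Z) ξ_s turns the two torsion traces into -2 ∑ ∇²f(ξ_s, I_s Y) and -2
∑ ∇²f(I_s Y, ξ_s). Swapping the arguments in the latter produces the terms T(ξ_s, I_s Y, Y) and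
raises the coefficient from 2 to 4. -/

open scoped Topology

noncomputable section

namespace QC

/-! ### Calculus of functions and vector fields -/

section Calculus

variable {n : ℕ} {M : Type*} [TopologicalSpace M] [ChartedSpace (Model n) M]

/-- Differentiability at `x` of a real function. -/
def DiffFunAt (f : M → ℝ) (x : M) : Prop :=
  MDifferentiableAt (𝓡 (4 * n + 3)) 𝓘(ℝ, ℝ) f x

theorem DiffFunAt.const (c : ℝ) (x : M) : DiffFunAt (n := n) (fun _ ↦ c) x :=
  mdifferentiableAt_const

theorem DiffFunAt.add {f g : M → ℝ} {x : M} (hf : DiffFunAt (n := n) f x)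
    (hg : DiffFunAt (n := n) g x) : DiffFunAt (n := n) (fun y ↦ f y + g y) x :=
  MDifferentiableAt.add hf hg

theorem DiffFunAt.mul {f g : M → ℝ} {x : M} (hf : DiffFunAt (n := n) f x)
    (hg : DiffFunAt (n := n) g x) : DiffFunAt (n := n) (fun y ↦ f y * g y) x :=
  MDifferentiableAt.mul hf hg

theorem DiffFunAt.sum {ι : Type*} {s : Finset ι} {f : ι → M → ℝ} {x : M}
    (hf : ∀ i ∈ s, DiffFunAt (n := n) (f i) x) :
    DiffFunAt (n := n) (fun y ↦ ∑ i ∈ s, f i y) x := by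
  classical
  induction s using Finset.induction_on with
  | empty => simpa using DiffFunAt.const 0 x
  | insert a s ha h =>
    simp only [Finset.sum_insert ha]
    exact (hf a (by simp)).add (h fun i hi ↦ hf i (by simp [hi]))

theorem SmoothFunAt.diff {f : M → ℝ} {x : M} (hf : SmoothFunAt (n := n) f x) :
    DiffFunAt (n := n) f x :=
  ContMDiffAt.mdifferentiableAt hf (by simp)

theorem SmoothFunAt.const (c : ℝ) (x : M) : SmoothFunAt (n := n) (fun _ ↦ c) x :=
  contMDiffAt_const

theorem SmoothFunAt.mul {f g : M → ℝ} {x : M} (hf : SmoothFunAt (n := n) f x)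
    (hg : SmoothFunAt (n := n) g x) : SmoothFunAt (n := n) (fun y ↦ f y * g y) x :=
  ContMDiffAt.mul hf hg

theorem SmoothFunAt.sum {ι : Type*} {s : Finset ι} {f : ι → M → ℝ} {x : M}
    (hf : ∀ i ∈ s, SmoothFunAt (n := n) (f i) x) :
    SmoothFunAt (n := n) (fun y ↦ ∑ i ∈ s, f i y) x :=
  ContMDiffAt.sum hf

theorem differential_const (c : ℝ) (x : M) : differential (n := n) (fun _ ↦ c) x = 0 :=
  mvfderiv_const c

theorem differential_add {f g : M → ℝ} {x : M} (hf : DiffFunAt (n := n) f x)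
    (hg : DiffFunAt (n := n) g x) :
    differential (n := n) (fun y ↦ f y + g y) x = differential f x + differential g x :=
  mvfderiv_add hf hg

theorem differential_sub {f g : M → ℝ} {x : M} (hf : DiffFunAt (n := n) f x)
    (hg : DiffFunAt (n := n) g x) :
    differential (n := n) (fun y ↦ f y - g y) x = differential f x - differential g x :=
  mvfderiv_sub hf hg

theorem differential_neg {f : M → ℝ} {x : M} :
    differential (n := n) (fun y ↦ -f y) x = -differential f x :=
  mvfderiv_neg

theorem differential_mul {f g : M → ℝ} {x : M} (hf : DiffFunAt (n := n) f x)
    (hg : DiffFunAt (n := n) g x) :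
    differential (n := n) (fun y ↦ f y * g y) x = f x • differential g x + g x • differential f x :=
  mvfderiv_mul hf hg

theorem differential_sum {ι : Type*} {s : Finset ι} {f : ι → M → ℝ} {x : M}
    (hf : ∀ i ∈ s, DiffFunAt (n := n) (f i) x) :
    differential (n := n) (fun y ↦ ∑ i ∈ s, f i y) x = ∑ i ∈ s, differential (f i) x := by
  classical
  induction s using Finset.induction_on with
  | empty => simpa using differential_const (n := n) 0 x
  | insert a s ha h =>
    simp only [Finset.sum_insert ha]
    rw [differential_add (hf a (by simp)) (DiffFunAt.sum fun i hi ↦ hf i (by simp [hi])),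
      h fun i hi ↦ hf i (by simp [hi])]

theorem differential_congr {f g : M → ℝ} {x : M} (h : ∀ᶠ y in 𝓝 x, f y = g y) :
    differential (n := n) f x = differential g x := by
  ext v
  have h2 : mfderiv (𝓡 (4 * n + 3)) 𝓘(ℝ, ℝ) f x = mfderiv (𝓡 (4 * n + 3)) 𝓘(ℝ, ℝ) g x :=
    Filter.EventuallyEq.mfderiv_eq h
  exact congrArg (fun L : Tan n x →L[ℝ] ℝ ↦ L v) h2

theorem bracket_congr {X X' Y Y' : Π y : M, Tan n y} {x : M} (h : ∀ᶠ y in 𝓝 x, X y = X' y)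
    (h' : ∀ᶠ y in 𝓝 x, Y y = Y' y) : bracket X Y x = bracket X' Y' x :=
  Filter.EventuallyEq.mlieBracket_vectorField_eq h h'

theorem bracket_swap (X Y : Π y : M, Tan n y) (x : M) : bracket X Y x = -bracket Y X x :=
  VectorField.mlieBracket_swap_apply

variable [IsManifold (𝓡 (4 * n + 3)) ∞ M]

/-- Differentiability at `x` of a vector field. -/
def DiffFieldAt (X : Π y : M, Tan n y) (x : M) : Prop :=
  MDifferentiableAt (𝓡 (4 * n + 3)) ((𝓡 (4 * n + 3)).prod 𝓘(ℝ, Model n))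
    (fun y ↦ (⟨y, X y⟩ : TangentBundle (𝓡 (4 * n + 3)) M)) x

theorem SmoothFieldAt.diff {X : Π y : M, Tan n y} {x : M} (hX : SmoothFieldAt X x) :
    DiffFieldAt X x :=
  ContMDiffAt.mdifferentiableAt hX (by simp)

theorem DiffFieldAt.add {X Y : Π y : M, Tan n y} {x : M} (hX : DiffFieldAt X x)
    (hY : DiffFieldAt Y x) : DiffFieldAt (fun y ↦ X y + Y y) x :=
  mdifferentiableAt_add_section hX hY

theorem DiffFunAt.smul {h : M → ℝ} {X : Π y : M, Tan n y} {x : M} (hh : DiffFunAt (n := n) h x)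
    (hX : DiffFieldAt X x) : DiffFieldAt (fun y ↦ h y • X y) x :=
  MDifferentiableAt.smul_section hh hX

theorem DiffFieldAt.sum {ι : Type*} {s : Finset ι} {X : ι → Π y : M, Tan n y} {x : M}
    (hX : ∀ i ∈ s, DiffFieldAt (X i) x) : DiffFieldAt (fun y ↦ ∑ i ∈ s, X i y) x :=
  MDifferentiableAt.sum_section hX

theorem SmoothFieldAt.add {X Y : Π y : M, Tan n y} {x : M} (hX : SmoothFieldAt X x)
    (hY : SmoothFieldAt Y x) : SmoothFieldAt (fun y ↦ X y + Y y) x :=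
  ContMDiffAt.add_section hX hY

theorem SmoothFieldAt.neg {X : Π y : M, Tan n y} {x : M} (hX : SmoothFieldAt X x) :
    SmoothFieldAt (fun y ↦ -X y) x :=
  ContMDiffAt.neg_section hX

theorem SmoothFieldAt.sub {X Y : Π y : M, Tan n y} {x : M} (hX : SmoothFieldAt X x)
    (hY : SmoothFieldAt Y x) : SmoothFieldAt (fun y ↦ X y - Y y) x :=
  ContMDiffAt.sub_section hX hY

theorem SmoothFunAt.smul {h : M → ℝ} {X : Π y : M, Tan n y} {x : M}
    (hh : SmoothFunAt (n := n) h x) (hX : SmoothFieldAt X x) :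
    SmoothFieldAt (fun y ↦ h y • X y) x :=
  ContMDiffAt.smul_section hh hX

theorem SmoothFieldAt.sum {ι : Type*} {s : Finset ι} {X : ι → Π y : M, Tan n y} {x : M}
    (hX : ∀ i ∈ s, SmoothFieldAt (X i) x) : SmoothFieldAt (fun y ↦ ∑ i ∈ s, X i y) x :=
  ContMDiffAt.sum_section hX

theorem SmoothFieldAt.congr {X Y : Π y : M, Tan n y} {x : M} (hX : SmoothFieldAt X x)
    (h : ∀ᶠ y in 𝓝 x, Y y = X y) : SmoothFieldAt Y x :=
  ContMDiffAt.congr_of_eventuallyEq hX (h.mono fun y hy ↦ by simp only [hy])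

theorem SmoothFunAt.differential_apply {f : M → ℝ} {X : Π y : M, Tan n y} {x : M}
    (hf : SmoothFunAt (n := n) f x) (hX : SmoothFieldAt X x) :
    SmoothFunAt (n := n) (fun y ↦ differential f y (X y)) x := by
  have h1 := ContMDiffAt.mfderiv_const (m := ∞) hf (by simp)
  have h2 := ContMDiffAt.clm_apply_of_inCoordinates (b₁ := id) (v := X) h1 hX hf
  rw [Bundle.contMDiffAt_totalSpace] at h2
  have h3 := h2.2
  simp only [trivializationAt_model_space_apply] at h3
  exact h3

/-- Tensoriality at a point is tested on fields that are merely differentiable there, so the smooth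
version does not suffice. -/
theorem SmoothFunAt.differential_apply_diff {f : M → ℝ} {X : Π y : M, Tan n y} {x : M}
    (hf : SmoothFunAt (n := n) f x) (hX : DiffFieldAt X x) :
    DiffFunAt (n := n) (fun y ↦ differential f y (X y)) x := by
  have h1 := ContMDiffAt.mfderiv_const (m := ∞) hf (by simp)
  have h2 := MDifferentiableAt.clm_apply_of_inCoordinates (b₁ := id) (v := X)
    (h1.mdifferentiableAt (by simp)) hX hf.diff
  rw [mdifferentiableAt_totalSpace] at h2
  have h3 := h2.2
  simp only [trivializationAt_model_space_apply] at h3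
  exact h3

theorem extField_apply {x : M} (v : Tan n x) : extField v x = v :=
  FiberBundle.extend_apply_self (Model n) (E := (TangentSpace (𝓡 (4 * n + 3)) : M → Type _)) v

theorem eventually_smoothFieldAt_extField {x : M} (v : Tan n x) :
    ∀ᶠ y in 𝓝 x, SmoothFieldAt (extField v) y := by
  obtain ⟨s, hs, h⟩ := FiberBundle.exists_contMDiffOn_extend (k := ∞) (𝓡 (4 * n + 3)) (Model n)
    (V := (TangentSpace (𝓡 (4 * n + 3)) : M → Type _)) v
  filter_upwards [eventually_mem_nhds_iff.2 hs] with y hy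
  exact h.contMDiffAt hy

theorem SmoothFieldAt.bracket {X Y : Π y : M, Tan n y} {x : M} (hX : SmoothFieldAt X x)
    (hY : SmoothFieldAt Y x) : SmoothFieldAt (fun y ↦ bracket X Y y) x := by
  have : IsManifold (𝓡 (4 * n + 3)) (minSmoothness ℝ 2) M := by
    simp only [minSmoothness_of_isRCLikeNormedField]
    infer_instance
  have : IsManifold (𝓡 (4 * n + 3)) (((⊤ : ℕ∞) : WithTop ℕ∞) + 1) M := by
    simpa using ‹IsManifold (𝓡 (4 * n + 3)) ∞ M›
  exact ContMDiffAt.mlieBracket_vectorField (m := ⊤) (n := ⊤) hX hY (by simp)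

theorem bracket_smul_right {h : M → ℝ} {X Y : Π y : M, Tan n y} {x : M}
    (hh : DiffFunAt (n := n) h x) (hY : DiffFieldAt Y x) :
    bracket X (fun y ↦ h y • Y y) x = differential h x (X x) • Y x + h x • bracket X Y x :=
  VectorField.mlieBracket_smul_right hh hY

theorem bracket_add_right {X Y Z : Π y : M, Tan n y} {x : M}
    (hY : DiffFieldAt Y x) (hZ : DiffFieldAt Z x) :
    bracket X (fun y ↦ Y y + Z y) x = bracket X Y x + bracket X Z x :=
  VectorField.mlieBracket_add_right hY hZ

theorem jacobi {X Y Z : Π y : M, Tan n y} {x : M} (hX : SmoothFieldAt X x)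
    (hY : SmoothFieldAt Y x) (hZ : SmoothFieldAt Z x) :
    bracket X (bracket Y Z) x = bracket (bracket X Y) Z x + bracket Y (bracket X Z) x := by
  have : IsManifold (𝓡 (4 * n + 3)) (minSmoothness ℝ 3) M := by
    simp only [minSmoothness_of_isRCLikeNormedField]
    exact IsManifold.of_le (n := ∞) (WithTop.coe_le_coe.2 (le_top : (3 : ℕ∞) ≤ ⊤))
  have h2 : minSmoothness ℝ 2 ≤ ∞ := by
    simp only [minSmoothness_of_isRCLikeNormedField]
    exact WithTop.coe_le_coe.2 (le_top : (2 : ℕ∞) ≤ ⊤)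
  exact VectorField.leibniz_identity_mlieBracket_apply (ContMDiffAt.of_le hX h2)
    (ContMDiffAt.of_le hY h2) (ContMDiffAt.of_le hZ h2)

/-- Follows from the Jacobi identity for X, Y and h Z with Z nonzero at x. Expanding every bracket
by the Leibniz rule and subtracting h times the identity for X, Y, Z leaves ([X, Y]h - X(Yh) +
Y(Xh)) Z = 0. -/
theorem differential_bracket {h : M → ℝ} {X Y : Π y : M, Tan n y} {x : M}
    (hh : ∀ᶠ y in 𝓝 x, SmoothFunAt (n := n) h y) (hX : ∀ᶠ y in 𝓝 x, SmoothFieldAt X y)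
    (hY : ∀ᶠ y in 𝓝 x, SmoothFieldAt Y y) :
    differential h x (bracket X Y x) = differential (fun y ↦ differential h y (Y y)) x (X x)
      - differential (fun y ↦ differential h y (X y)) x (Y x) := by
  have : Nontrivial (Tan n x) := inferInstanceAs (Nontrivial (Model n))
  obtain ⟨v, hv⟩ := exists_ne (0 : Tan n x)
  set Z : Π y : M, Tan n y := extField v with hZdef
  have hZ : ∀ᶠ y in 𝓝 x, SmoothFieldAt Z y := eventually_smoothFieldAt_extField v
  have hZx : Z x = v := extField_apply v
  have key : ∀ {A B : Π y : M, Tan n y}, (∀ᶠ y in 𝓝 x, SmoothFieldAt A y) →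
      (∀ᶠ y in 𝓝 x, SmoothFieldAt B y) →
      bracket A (bracket B (fun y ↦ h y • Z y)) x =
        (differential (fun y ↦ differential h y (B y)) x (A x) • Z x
          + differential h x (B x) • bracket A Z x)
        + (differential h x (A x) • bracket B Z x + h x • bracket A (bracket B Z) x) := by
    intro A B hA hB
    have e1 : ∀ᶠ y in 𝓝 x, bracket B (fun y ↦ h y • Z y) y =
        differential h y (B y) • Z y + h y • bracket B Z y := by
      filter_upwards [hh, hZ] with y h1 h2
      exact bracket_smul_right h1.diff h2.diff
    rw [bracket_congr (Filter.Eventually.of_forall fun _ ↦ rfl) e1]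
    have s1 := hh.self_of_nhds
    have s2 := hZ.self_of_nhds
    have s3 := hB.self_of_nhds
    have d1 := (s1.differential_apply s3).diff
    have d2 : DiffFieldAt (bracket B Z) x := (s3.bracket s2).diff
    rw [bracket_add_right (DiffFunAt.smul d1 s2.diff) (DiffFunAt.smul s1.diff d2),
      bracket_smul_right d1 s2.diff, bracket_smul_right s1.diff d2]
  have s1 := hh.self_of_nhds
  have s2 := hZ.self_of_nhds
  have J1 := jacobi hX.self_of_nhds hY.self_of_nhds (SmoothFunAt.smul s1 s2)
  have J2 := jacobi hX.self_of_nhds hY.self_of_nhds s2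
  rw [key hX hY, key hY hX, bracket_smul_right s1.diff s2.diff, J2] at J1
  have : (differential h x (bracket X Y x) - (differential (fun y ↦ differential h y (Y y)) x (X x)
      - differential (fun y ↦ differential h y (X y)) x (Y x))) • Z x = 0 := by
    linear_combination (norm := module) -J1
  rw [hZx] at this
  exact sub_eq_zero.1 ((smul_eq_zero.1 this).resolve_right hv)

/-- The form is read as a linear function of the preferred chart at x, whose derivative at x is the
identity of the tangent space (`tangentCoordChange` from x to x). -/
theorem exists_smoothFunAt_differential_eq (x : M) (θ : Tan n x →ₗ[ℝ] ℝ) :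
    ∃ h : M → ℝ, (∀ᶠ y in 𝓝 x, SmoothFunAt (n := n) h y) ∧ h x = 0 ∧
      ∀ v, differential h x v = θ v := by
  set c : M → Model n := fun y ↦ extChartAt (𝓡 (4 * n + 3)) x y with hc
  have hcs : ∀ᶠ y in 𝓝 x, ContMDiffAt (𝓡 (4 * n + 3)) 𝓘(ℝ, Model n) ∞ c y := by
    filter_upwards [(chartAt (Model n) x).open_source.mem_nhds (mem_chart_source _ x)] with y hy
    exact contMDiffAt_extChartAt' hy
  let L : Model n →L[ℝ] ℝ := LinearMap.toContinuousLinearMap (E := Model n) θ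
  have hL : ∀ y, ContMDiffAt 𝓘(ℝ, Model n) 𝓘(ℝ, ℝ) ∞ L y := fun y ↦ L.contMDiff.contMDiffAt
  refine ⟨fun y ↦ L (c y) - L (c x), ?_, by simp, fun v ↦ ?_⟩
  · filter_upwards [hcs] with y hy
    exact ContMDiffAt.sub ((hL (c y)).comp y hy) contMDiffAt_const
  · have h1 : DiffFunAt (n := n) (fun y ↦ L (c y)) x :=
      SmoothFunAt.diff ((hL (c x)).comp x hcs.self_of_nhds)
    rw [differential_sub h1 (DiffFunAt.const _ _), differential_const, sub_zero]
    have h2 : HasMFDerivAt (𝓡 (4 * n + 3)) 𝓘(ℝ, Model n) c x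
        (mfderiv (𝓡 (4 * n + 3)) (𝓡 (4 * n + 3)) (chartAt (Model n) x) x) :=
      hasMFDerivAt_extChartAt (mem_chart_source _ x)
    have h3 := (L.hasMFDerivAt (x := c x)).comp x h2
    rw [mfderiv_chartAt_eq_tangentCoordChange (mem_chart_source _ x)] at h3
    have h4 : mfderiv (𝓡 (4 * n + 3)) 𝓘(ℝ, ℝ) (fun y ↦ L (c y)) x v =
        L (tangentCoordChange (𝓡 (4 * n + 3)) x x x v) :=
      congrArg (fun K : Tan n x →L[ℝ] ℝ ↦ K v) h3.mfderiv
    exact h4.trans (congrArg L (tangentCoordChange_self (mem_extChartAt_source x)))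

end Calculus

/-! ### Second derivatives, torsion and curvature of a connection -/

namespace Connection

variable {n : ℕ} {M : Type*} [TopologicalSpace M] [ChartedSpace (Model n) M]
  [IsManifold (𝓡 (4 * n + 3)) ∞ M] (D : Connection n M)

theorem D_add {X Y : Π y : M, Tan n y} {x : M} (hX : DiffFieldAt X x) (hY : DiffFieldAt Y x) :
    D (fun y ↦ X y + Y y) x = D X x + D Y x :=
  D.isCovariantDerivativeOnUniv.add hX hY

theorem D_smul {h : M → ℝ} {X : Π y : M, Tan n y} {x : M} (hh : DiffFunAt (n := n) h x)
    (hX : DiffFieldAt X x) (v : Tan n x) :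
    D (fun y ↦ h y • X y) x v = h x • D X x v + differential h x v • X x :=
  congrArg (fun L : Tan n x →L[ℝ] Tan n x ↦ L v)
    (D.isCovariantDerivativeOnUniv.leibniz hX hh)

theorem D_congr {X Y : Π y : M, Tan n y} {x : M} (hX : DiffFieldAt X x) (hY : DiffFieldAt Y x)
    (h : ∀ᶠ y in 𝓝 x, X y = Y y) : D X x = D Y x :=
  D.isCovariantDerivativeOnUniv.congr_of_eventuallyEq hX hY Filter.univ_mem h

theorem D_sum {ι : Type*} {s : Finset ι} {X : ι → Π y : M, Tan n y} {x : M}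
    (hX : ∀ i ∈ s, DiffFieldAt (X i) x) :
    D (fun y ↦ ∑ i ∈ s, X i y) x = ∑ i ∈ s, D (X i) x := by
  classical
  induction s using Finset.induction_on with
  | empty =>
    simp only [Finset.sum_empty]
    exact congrFun (D.zero) x
  | insert a s ha h =>
    simp only [Finset.sum_insert ha]
    rw [D_add D (hX a (by simp)) (DiffFieldAt.sum fun i hi ↦ hX i (by simp [hi])),
      h fun i hi ↦ hX i (by simp [hi])]

theorem T_apply {X Y : Π y : M, Tan n y} {x : M} (hX : DiffFieldAt X x) (hY : DiffFieldAt Y x) :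
    D.T x (X x) (Y x) = D Y x (X x) - D X x (Y x) - bracket X Y x :=
  D.torsion_apply hX hY

/-- A connection is smooth if it maps smooth fields to smooth fields, locally. -/
def IsSmooth : Prop :=
  ∀ U : Set M, IsOpen U → ContMDiffCovariantDerivativeOn (Model n) ∞ D.toFun U

variable {D}

theorem IsSmooth.contMDiffAt (hD : D.IsSmooth) {X : Π y : M, Tan n y} {x : M}
    (hX : ∀ᶠ y in 𝓝 x, SmoothFieldAt X y) :
    ContMDiffAt (𝓡 (4 * n + 3)) ((𝓡 (4 * n + 3)).prod 𝓘(ℝ, Model n →L[ℝ] Model n)) ∞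
      (fun y ↦ (⟨y, D X y⟩ : Bundle.TotalSpace (Model n →L[ℝ] Model n)
        fun y : M ↦ TangentSpace (𝓡 (4 * n + 3)) y →L[ℝ] TangentSpace (𝓡 (4 * n + 3)) y)) x := by
  obtain ⟨U, hU, hUo, hxU⟩ := eventually_nhds_iff.1 hX
  have h := (hD U hUo).contMDiff (σ := X) (fun y hy ↦ (hU y hy).contMDiffWithinAt)
  exact h.contMDiffAt (hUo.mem_nhds hxU)

theorem IsSmooth.smoothFieldAt (hD : D.IsSmooth) {X Z : Π y : M, Tan n y} {x : M}
    (hX : ∀ᶠ y in 𝓝 x, SmoothFieldAt X y) (hZ : SmoothFieldAt Z x) :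
    SmoothFieldAt (fun y ↦ D X y (Z y)) x :=
  ContMDiffAt.clm_bundle_apply (hD.contMDiffAt hX) hZ

theorem IsSmooth.diffFieldAt (hD : D.IsSmooth) {X Z : Π y : M, Tan n y} {x : M}
    (hX : ∀ᶠ y in 𝓝 x, SmoothFieldAt X y) (hZ : DiffFieldAt Z x) :
    DiffFieldAt (fun y ↦ D X y (Z y)) x :=
  MDifferentiableAt.clm_bundle_apply ((hD.contMDiffAt hX).mdifferentiableAt (by simp)) hZ

variable (D)

/-- The term dh · Xf from the product rule cancels the one from the Leibniz rule of `D`. Only the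
second slot needs this; the first is pointwise linear by construction. -/
theorem tensorialAt_hess {f : M → ℝ} {x : M} (hf : SmoothFunAt (n := n) f x) :
    TensorialAt (𝓡 (4 * n + 3)) (Model n) (V := (TangentSpace (𝓡 (4 * n + 3)) : M → Type _))
      (fun X : Π y : M, Tan n y ↦ (differential (fun y ↦ differential f y (X y)) x
        - differential f x ∘L D X x : Tan n x →L[ℝ] ℝ)) x where
  smul {h X} hh hX := by
    have e : (fun y ↦ differential f y ((h • X) y)) = fun y ↦ h y * differential f y (X y) := by
      ext y; simp
    ext v
    have hs : D (h • X) x v = h x • D X x v + differential h x v • X x := D_smul D hh hX v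
    rw [e, differential_mul hh (hf.differential_apply_diff hX)]
    simp [hs]
    ring
  add {X Y} hX hY := by
    have e : (fun y ↦ differential f y ((X + Y) y)) =
        fun y ↦ differential f y (X y) + differential f y (Y y) := by
      ext y; simp
    ext v
    have hs : D (X + Y) x = D X x + D Y x := D_add D hX hY
    rw [e, differential_add (hf.differential_apply_diff hX) (hf.differential_apply_diff hY)]
    simp [hs]
    ring

/-- The second covariant derivative as a bilinear form. -/
def hessBilin {f : M → ℝ} {x : M} (hf : SmoothFunAt (n := n) f x) :
    Tan n x →L[ℝ] Tan n x →L[ℝ] ℝ :=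
  TensorialAt.mkHom _ x (D.tensorialAt_hess hf)

theorem hess_eq_hessBilin {f : M → ℝ} {x : M} (hf : SmoothFunAt (n := n) f x) (u v : Tan n x) :
    D.hess f x u v = D.hessBilin hf v u := by
  rw [hessBilin, TensorialAt.mkHom_apply_eq_extend]
  rfl

theorem hess_apply {f : M → ℝ} {x : M} (hf : SmoothFunAt (n := n) f x) {X : Π y : M, Tan n y}
    (hX : DiffFieldAt X x) (u : Tan n x) :
    D.hess f x u (X x) =
      differential (fun y ↦ differential f y (X y)) x u - differential f x (D X x u) := by
  rw [hess_eq_hessBilin D hf, hessBilin, TensorialAt.mkHom_apply _ hX]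
  rfl

/-- The second derivatives of f combine to [u, v]f, and the remaining terms are the definition of
the torsion. -/
theorem hess_sub_hess_swap {f : M → ℝ} {x : M} (hf : ∀ᶠ y in 𝓝 x, SmoothFunAt (n := n) f y)
    (u v : Tan n x) : D.hess f x u v - D.hess f x v u = -differential f x (D.T x u v) := by
  have hu := eventually_smoothFieldAt_extField u
  have hv := eventually_smoothFieldAt_extField v
  have h1 := D.hess_apply hf.self_of_nhds hv.self_of_nhds.diff u
  have h2 := D.hess_apply hf.self_of_nhds hu.self_of_nhds.diff v
  have h3 := D.T_apply hu.self_of_nhds.diff hv.self_of_nhds.diff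
  have h4 := differential_bracket hf hu hv
  simp only [extField_apply] at h1 h2 h3 h4
  rw [h1, h2, h3, map_sub, map_sub, h4]
  ring

/-- The curvature expression `∇_X ∇_Z W - ∇_Z ∇_X W - ∇_[X, Z] W` on vector fields. -/
def curv (X Z W : Π y : M, Tan n y) (x : M) : Tan n x :=
  D (fun y ↦ D W y (Z y)) x (X x) - D (fun y ↦ D W y (X y)) x (Z x) - D W x (bracket X Z x)

variable {D}

theorem IsSmooth.tensorialAt_curv_left (hD : D.IsSmooth) {Z W : Π y : M, Tan n y} {x : M}
    (hW : ∀ᶠ y in 𝓝 x, SmoothFieldAt W y) :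
    TensorialAt (𝓡 (4 * n + 3)) (Model n) (V := (TangentSpace (𝓡 (4 * n + 3)) : M → Type _))
      (fun X : Π y : M, Tan n y ↦ D.curv X Z W x) x where
  smul {h X} hh hX := by
    have e : (fun y ↦ D W y ((h • X) y)) = fun y ↦ h y • D W y (X y) := by
      ext1 y; simp
    have hb : bracket (h • X) Z x = -(differential h x (Z x) • X x + h x • bracket Z X x) := by
      rw [bracket_swap]
      exact congrArg _ (bracket_smul_right hh hX)
    have hb' : bracket X Z x = -bracket Z X x := bracket_swap _ _ _
    unfold curv
    rw [e, D_smul D hh (hD.diffFieldAt hW hX), hb, hb']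
    simp
    module
  add {X Y} hX hY := by
    have e : (fun y ↦ D W y ((X + Y) y)) = fun y ↦ D W y (X y) + D W y (Y y) := by
      ext1 y; simp
    have hb : bracket (X + Y) Z x = bracket X Z x + bracket Y Z x := by
      rw [bracket_swap _ Z, bracket_swap X Z, bracket_swap Y Z, ← neg_add]
      exact congrArg _ (bracket_add_right hX hY)
    unfold curv
    rw [e, D_add D (hD.diffFieldAt hW hX) (hD.diffFieldAt hW hY), hb]
    simp
    module

theorem curv_swap (X Z W : Π y : M, Tan n y) (x : M) : D.curv X Z W x = -D.curv Z X W x := by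
  unfold curv
  rw [bracket_swap X Z, map_neg]
  module

theorem IsSmooth.curv_congr_left (hD : D.IsSmooth) {X X' Z W : Π y : M, Tan n y} {x : M}
    (hW : ∀ᶠ y in 𝓝 x, SmoothFieldAt W y) (hX : DiffFieldAt X x) (hX' : DiffFieldAt X' x)
    (h : X x = X' x) : D.curv X Z W x = D.curv X' Z W x :=
  (hD.tensorialAt_curv_left hW).pointwise hX hX' h

/-- The mixed first-order terms are symmetric in X and Z, and the second derivatives of h cancel
against `differential_bracket`. -/
theorem IsSmooth.curv_smul (hD : D.IsSmooth) {h : M → ℝ} {X Z W : Π y : M, Tan n y} {x : M}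
    (hh : ∀ᶠ y in 𝓝 x, SmoothFunAt (n := n) h y) (hX : ∀ᶠ y in 𝓝 x, SmoothFieldAt X y)
    (hZ : ∀ᶠ y in 𝓝 x, SmoothFieldAt Z y) (hW : ∀ᶠ y in 𝓝 x, SmoothFieldAt W y) :
    D.curv X Z (fun y ↦ h y • W y) x = h x • D.curv X Z W x := by
  have key : ∀ {A B : Π y : M, Tan n y}, (∀ᶠ y in 𝓝 x, SmoothFieldAt A y) →
      D (fun y ↦ D (fun y ↦ h y • W y) y (A y)) x (B x) =
        h x • D (fun y ↦ D W y (A y)) x (B x) + differential h x (B x) • D W x (A x)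
        + (differential h x (A x) • D W x (B x)
          + differential (fun y ↦ differential h y (A y)) x (B x) • W x) := by
    intro A B hA
    have e : ∀ᶠ y in 𝓝 x, D (fun y ↦ h y • W y) y (A y) =
        h y • D W y (A y) + differential h y (A y) • W y := by
      filter_upwards [hh, hW] with y h1 h2
      exact D_smul D h1.diff h2.diff _
    have d1 := (hD.smoothFieldAt hW hA.self_of_nhds).diff
    have d2 := (hh.self_of_nhds.differential_apply hA.self_of_nhds).diff
    have d3 := hh.self_of_nhds.diff
    have d4 := hW.self_of_nhds.diff
    have d5 : DiffFieldAt (fun y ↦ D (fun y ↦ h y • W y) y (A y)) x :=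
      (hD.smoothFieldAt (by filter_upwards [hh, hW] with y h1 h2 using h1.smul h2)
        hA.self_of_nhds).diff
    rw [D_congr D d5 ((d3.smul d1).add (d2.smul d4)) e, D_add D (d3.smul d1) (d2.smul d4),
      add_apply, D_smul D d3 d1, D_smul D d2 d4]
  unfold curv
  rw [key hX, key hZ, D_smul D hh.self_of_nhds.diff hW.self_of_nhds.diff,
    differential_bracket hh hX hZ]
  module

theorem IsSmooth.curv_add (hD : D.IsSmooth) {X Z W W' : Π y : M, Tan n y} {x : M}
    (hX : SmoothFieldAt X x) (hZ : SmoothFieldAt Z x)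
    (hW : ∀ᶠ y in 𝓝 x, SmoothFieldAt W y) (hW' : ∀ᶠ y in 𝓝 x, SmoothFieldAt W' y) :
    D.curv X Z (fun y ↦ W y + W' y) x = D.curv X Z W x + D.curv X Z W' x := by
  have key : ∀ {A B : Π y : M, Tan n y}, SmoothFieldAt A x →
      D (fun y ↦ D (fun y ↦ W y + W' y) y (A y)) x (B x) =
        D (fun y ↦ D W y (A y)) x (B x) + D (fun y ↦ D W' y (A y)) x (B x) := by
    intro A B hA
    have e : ∀ᶠ y in 𝓝 x, D (fun y ↦ W y + W' y) y (A y) = D W y (A y) + D W' y (A y) := by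
      filter_upwards [hW, hW'] with y h1 h2
      rw [D_add D h1.diff h2.diff, add_apply]
    have d1 := (hD.smoothFieldAt hW hA).diff
    have d2 := (hD.smoothFieldAt hW' hA).diff
    have d5 : DiffFieldAt (fun y ↦ D (fun y ↦ W y + W' y) y (A y)) x :=
      (hD.smoothFieldAt (by filter_upwards [hW, hW'] with y h1 h2 using h1.add h2) hA).diff
    rw [D_congr D d5 (d1.add d2) e, D_add D d1 d2, add_apply]
  unfold curv
  rw [key hX, key hZ, D_add D hW.self_of_nhds.diff hW'.self_of_nhds.diff,
    add_apply]
  module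

theorem IsSmooth.curv_congr (hD : D.IsSmooth) {X Z W W' : Π y : M, Tan n y} {x : M}
    (hX : SmoothFieldAt X x) (hZ : SmoothFieldAt Z x)
    (hW : ∀ᶠ y in 𝓝 x, SmoothFieldAt W y) (h : ∀ᶠ y in 𝓝 x, W y = W' y) :
    D.curv X Z W x = D.curv X Z W' x := by
  have hW' : ∀ᶠ y in 𝓝 x, SmoothFieldAt W' y := by
    filter_upwards [hW, h.eventually_nhds] with y h1 h2
    exact h1.congr (h2.mono fun _ ↦ Eq.symm)
  have e : ∀ᶠ y in 𝓝 x, D W y = D W' y := by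
    filter_upwards [hW, hW', h.eventually_nhds] with y h1 h2 h3
    exact D_congr D h1.diff h2.diff h3
  unfold curv
  rw [D_congr D (hD.smoothFieldAt hW hZ).diff (hD.smoothFieldAt hW' hZ).diff
      (e.mono fun y hy ↦ by rw [hy]),
    D_congr D (hD.smoothFieldAt hW hX).diff (hD.smoothFieldAt hW' hX).diff
      (e.mono fun y hy ↦ by rw [hy]), e.self_of_nhds]

theorem IsSmooth.curv_sum (hD : D.IsSmooth) {ι : Type*} (s : Finset ι) {X Z : Π y : M, Tan n y}
    {W : ι → Π y : M, Tan n y} {x : M} (hX : SmoothFieldAt X x) (hZ : SmoothFieldAt Z x)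
    (hW : ∀ i ∈ s, ∀ᶠ y in 𝓝 x, SmoothFieldAt (W i) y) :
    D.curv X Z (fun y ↦ ∑ i ∈ s, W i y) x = ∑ i ∈ s, D.curv X Z (W i) x := by
  classical
  induction s using Finset.induction_on with
  | empty =>
    have h0 : D (fun y : M ↦ (0 : Tan n y)) = 0 := D.zero
    simp [curv, h0]
  | insert a s ha h =>
    simp only [Finset.sum_insert ha]
    rw [hD.curv_add hX hZ (hW a (by simp)), h fun i hi ↦ hW i (by simp [hi])]
    have : ∀ᶠ y in 𝓝 x, ∀ i ∈ s, SmoothFieldAt (W i) y :=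
      (Filter.eventually_all_finset s).2 fun i hi ↦ hW i (by simp [hi])
    exact this.mono fun y hy ↦ SmoothFieldAt.sum hy

/-- Two derivatives of W are taken, so W must be smooth near x and `TensorialAt`, which sees fields
only differentiable at x, does not apply. Instead W is expanded in a local frame; its smooth
coefficients vanish at x and come out of the curvature. -/
theorem IsSmooth.curv_eq_zero (hD : D.IsSmooth) {X Z W : Π y : M, Tan n y} {x : M}
    (hX : ∀ᶠ y in 𝓝 x, SmoothFieldAt X y) (hZ : ∀ᶠ y in 𝓝 x, SmoothFieldAt Z y)
    (hW : ∀ᶠ y in 𝓝 x, SmoothFieldAt W y) (h0 : W x = 0) : D.curv X Z W x = 0 := by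
  let t := trivializationAt (Model n) (TangentSpace (𝓡 (4 * n + 3)) : M → Type _) x
  have hx : x ∈ t.baseSet := FiberBundle.mem_baseSet_trivializationAt' x
  have ht : ∀ᶠ y in 𝓝 x, y ∈ t.baseSet := t.open_baseSet.mem_nhds hx
  let b := Module.finBasis ℝ (Model n)
  let c := fun i y ↦ t.localFrameCoeff (𝓡 (4 * n + 3)) b i y (W y)
  have e : ∀ᶠ y in 𝓝 x, W y = ∑ i, c i y • t.localFrame b i y :=
    t.eventually_eq_localFrame_sum_coeff_smul b hx
  have hF : ∀ i, ∀ᶠ y in 𝓝 x, SmoothFieldAt (t.localFrame b i) y := fun i ↦ by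
    filter_upwards [ht] with y hy
    exact contMDiffAt_localFrame_of_mem ∞ _ b i hy
  have hc : ∀ i, ∀ᶠ y in 𝓝 x, SmoothFunAt (n := n) (c i) y := fun i ↦ by
    filter_upwards [ht, hW] with y hy h
    exact contMDiffAt_localFrameCoeff b hy h i
  rw [hD.curv_congr hX.self_of_nhds hZ.self_of_nhds hW e,
    hD.curv_sum _ hX.self_of_nhds hZ.self_of_nhds fun i _ ↦ by
      filter_upwards [hc i, hF i] with y h1 h2 using h1.smul h2]
  refine Finset.sum_eq_zero fun i _ ↦ ?_
  rw [hD.curv_smul (hc i) hX hZ (hF i)]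
  simp [c, h0]

/-- Frees the curvature from the particular extensions in its definition: the first two slots by
tensoriality, the third because the difference of two extensions vanishes at x. -/
theorem IsSmooth.R_apply (hD : D.IsSmooth) {X Z W : Π y : M, Tan n y} {x : M}
    (hX : ∀ᶠ y in 𝓝 x, SmoothFieldAt X y) (hZ : ∀ᶠ y in 𝓝 x, SmoothFieldAt Z y)
    (hW : ∀ᶠ y in 𝓝 x, SmoothFieldAt W y) :
    D.R x (X x) (Z x) (W x) = D.curv X Z W x := by
  have h1 : D.R x (X x) (Z x) (W x) =
      D.curv (extField (X x)) (extField (Z x)) (extField (W x)) x := by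
    unfold R curv
    simp only [extField_apply]
  have eX := eventually_smoothFieldAt_extField (X x)
  have eZ := eventually_smoothFieldAt_extField (Z x)
  have eW := eventually_smoothFieldAt_extField (W x)
  rw [h1, hD.curv_congr_left eW eX.self_of_nhds.diff hX.self_of_nhds.diff (extField_apply _),
    curv_swap, hD.curv_congr_left eW eZ.self_of_nhds.diff hZ.self_of_nhds.diff (extField_apply _),
    ← curv_swap]
  have eN : ∀ᶠ y in 𝓝 x, SmoothFieldAt (fun y ↦ extField (W x) y - W y) y := by
    filter_upwards [eW, hW] with y a b using a.sub b
  have h2 := hD.curv_add hX.self_of_nhds hZ.self_of_nhds hW eN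
  rw [hD.curv_eq_zero hX hZ eN (by simp [extField_apply])] at h2
  simpa using h2

end Connection

/-! ### Smooth dependence of inverse matrices -/

section Matrix

variable {n : ℕ} {M : Type*} [TopologicalSpace M] [ChartedSpace (Model n) M]
  {ι : Type*} [Fintype ι] [DecidableEq ι]

theorem smoothFunAt_det {K : M → Matrix ι ι ℝ} {x : M}
    (hK : ∀ i j, SmoothFunAt (n := n) (fun y ↦ K y i j) x) :
    SmoothFunAt (n := n) (fun y ↦ (K y).det) x := by
  simp only [Matrix.det_apply']
  exact SmoothFunAt.sum fun σ _ ↦ (SmoothFunAt.const _ x).mul (ContMDiffAt.prod fun i _ ↦ hK _ _)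

theorem smoothFunAt_inv {K : M → Matrix ι ι ℝ} {x : M}
    (hK : ∀ i j, SmoothFunAt (n := n) (fun y ↦ K y i j) x) (h0 : (K x).det ≠ 0) (i j : ι) :
    SmoothFunAt (n := n) (fun y ↦ (K y)⁻¹ i j) x := by
  simp only [Matrix.inv_def, Matrix.smul_apply, Ring.inverse_eq_inv', smul_eq_mul,
    Matrix.adjugate_apply]
  refine SmoothFunAt.mul (ContMDiffAt.inv₀ (smoothFunAt_det hK) h0) (smoothFunAt_det fun k l ↦ ?_)
  by_cases h : k = j
  · subst h
    simpa using SmoothFunAt.const _ x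
  · simpa [Matrix.updateRow_ne h] using hK k l

end Matrix

/-! ### Horizontal linear algebra and parallel extensions -/

namespace QCStructure

variable {n : ℕ} {M : Type*} [TopologicalSpace M] [ChartedSpace (Model n) M]
  [IsManifold (𝓡 (4 * n + 3)) ∞ M] (S : QCStructure n M)

theorem g_e (x : M) (a b : Fin (4 * n)) : S.g x (S.e x a) (S.e x b) = if a = b then 1 else 0 :=
  (S.exists_orthonormalBasis x).choose_spec a b

theorem sum_g_smul_e (x : M) (X : S.H x) : ∑ a, S.g x X (S.e x a) • S.e x a = X := by
  conv_rhs => rw [← (S.e x).sum_repr X]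
  refine Finset.sum_congr rfl fun a _ ↦ ?_
  have h := congrArg (fun Z ↦ S.g x Z (S.e x a)) ((S.e x).sum_repr X)
  simp only [map_sum, map_smul, LinearMap.sum_apply, LinearMap.smul_apply, g_e, smul_eq_mul,
    mul_ite, mul_one, mul_zero, Finset.sum_ite_eq', Finset.mem_univ, if_true] at h
  rw [h]

theorem sum_g_mul_g (x : M) (X Z : S.H x) :
    ∑ a, S.g x X (S.e x a) * S.g x Z (S.e x a) = S.g x X Z := by
  conv_rhs => rw [← S.sum_g_smul_e x Z]
  simp [mul_comm]

theorem sum_linear_mul_g (x : M) (L : S.H x →ₗ[ℝ] ℝ) (Z : S.H x) :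
    ∑ a, S.g x Z (S.e x a) * L (S.e x a) = L Z := by
  conv_rhs => rw [← S.sum_g_smul_e x Z]
  simp

theorem eq_of_g_eq {x : M} {X Z : S.H x} (h : ∀ W, S.g x X W = S.g x Z W) : X = Z := by
  rw [← S.sum_g_smul_e x X, ← S.sum_g_smul_e x Z]
  simp [h]

/-- The trace of a bilinear form with respect to `g`, in an arbitrary basis. -/
theorem sum_e_eq_sum_gram_inv (x : M) (E : Fin (4 * n) → S.H x)
    (hK : (Matrix.of fun a b ↦ S.g x (E a) (E b)).det ≠ 0) (B : LinearMap.BilinForm ℝ (S.H x)) :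
    ∑ a, B (S.e x a) (S.e x a) =
      ∑ a, ∑ b, (Matrix.of fun a b ↦ S.g x (E a) (E b))⁻¹ a b * B (E a) (E b) := by
  set K := Matrix.of fun a b ↦ S.g x (E a) (E b) with hKdef
  let P : Matrix (Fin (4 * n)) (Fin (4 * n)) ℝ := Matrix.of fun a c ↦ S.g x (E a) (S.e x c)
  let N : Matrix (Fin (4 * n)) (Fin (4 * n)) ℝ := Matrix.of fun a b ↦ B (S.e x a) (S.e x b)
  have hKP : K = P * P.transpose := by
    ext a b
    simp [hKdef, P, Matrix.mul_apply, S.sum_g_mul_g]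
  have hE : ∀ a, E a = ∑ c, P a c • S.e x c := fun a ↦ (S.sum_g_smul_e x (E a)).symm
  have hBE : (Matrix.of fun a b ↦ B (E a) (E b)) = P * N * P.transpose := by
    ext a b
    simp only [Matrix.of_apply, Matrix.mul_apply, Matrix.transpose_apply, N]
    rw [hE a, hE b]
    simp only [map_sum, map_smul, LinearMap.sum_apply, LinearMap.smul_apply, smul_eq_mul,
      Finset.mul_sum, Finset.sum_mul]
    exact Finset.sum_congr rfl fun _ _ ↦ Finset.sum_congr rfl fun _ _ ↦ by ring
  have hP : IsUnit P.det := by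
    rw [hKP, Matrix.det_mul] at hK
    exact (left_ne_zero_of_mul hK).isUnit
  have hKs : K.transpose = K := by
    rw [hKP, Matrix.transpose_mul, Matrix.transpose_transpose]
  have h1 : ∑ a, ∑ b, K⁻¹ a b * B (E a) (E b) =
      (K⁻¹ * (Matrix.of fun a b ↦ B (E a) (E b)).transpose).trace := by
    simp [Matrix.trace, Matrix.mul_apply]
  have hPT : IsUnit P.transpose.det := by rwa [Matrix.det_transpose]
  rw [h1, hBE, hKP, Matrix.mul_inv_rev, Matrix.transpose_mul, Matrix.transpose_mul,
    Matrix.transpose_transpose]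
  have h2 : (P.transpose⁻¹ * P⁻¹ * (P * (N.transpose * P.transpose))) =
      P.transpose⁻¹ * (N.transpose * P.transpose) := by
    rw [Matrix.mul_assoc, ← Matrix.mul_assoc P⁻¹, Matrix.nonsing_inv_mul _ hP, Matrix.one_mul]
  rw [h2, Matrix.trace_mul_comm, Matrix.mul_assoc, Matrix.mul_nonsing_inv _ hPT, Matrix.mul_one,
    Matrix.trace_transpose]
  simp [Matrix.trace, N]

variable {S} (C : S.Complement)

theorem Complement.hor_coe (x : M) (X : S.H x) : C.hor x (X : Tan n x) = X :=
  Submodule.projectionOnto_apply_left (C.isCompl x) X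

theorem Complement.coe_hor {x : M} {v : Tan n x} (hv : v ∈ S.H x) : (C.hor x v : Tan n x) = v :=
  congrArg Subtype.val (C.hor_coe x ⟨v, hv⟩)

theorem Complement.coe_hor_add_coe_ver (x : M) (v : Tan n x) :
    (C.hor x v : Tan n x) + (C.ver x v : Tan n x) = v :=
  Submodule.projection_add_projection_eq_self (C.isCompl x) v

theorem Complement.smoothAt_hor {X : Π y : M, Tan n y} {x : M} (hX : SmoothFieldAt X x) :
    S.SmoothAt (fun y ↦ C.hor y (X y)) x :=
  C.smooth x X hX

/-- A horizontal field with value `v` at `x`, smooth near `x`. -/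
def Complement.extend {x : M} (v : S.H x) (y : M) : S.H y :=
  C.hor y (extField (v : Tan n x) y)

theorem Complement.extend_apply {x : M} (v : S.H x) : C.extend v x = v := by
  rw [extend, extField_apply, hor_coe]

theorem Complement.eventually_smoothAt_extend {x : M} (v : S.H x) :
    ∀ᶠ y in 𝓝 x, S.SmoothAt (C.extend v) y := by
  filter_upwards [eventually_smoothFieldAt_extField (v : Tan n x)] with y hy
  exact C.smoothAt_hor hy

/-- The covariant derivative `∇_Z X` of a horizontal field `X`. -/
def Complement.nab (D : Connection n M) (X : Π y : M, S.H y) (Z : Π y : M, Tan n y) (y : M) :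
    S.H y :=
  C.hor y (D (fun y ↦ (X y : Tan n y)) y (Z y))

variable {C} {D : Connection n M} (hD : S.IsBiquard C D)
include hD

theorem IsBiquard.isSmooth : D.IsSmooth := hD.smooth

theorem IsBiquard.coe_nab {X : Π y : M, S.H y} {Z : Π y : M, Tan n y} {x : M}
    (hX : S.SmoothAt X x) :
    (C.nab D X Z x : Tan n x) = D (fun y ↦ (X y : Tan n y)) x (Z x) :=
  C.coe_hor (hD.preserves_H x X hX _)

theorem IsBiquard.smoothAt_nab {X : Π y : M, S.H y} {Z : Π y : M, Tan n y} {x : M}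
    (hX : ∀ᶠ y in 𝓝 x, S.SmoothAt X y) (hZ : SmoothFieldAt Z x) :
    S.SmoothAt (C.nab D X Z) x :=
  C.smoothAt_hor (hD.isSmooth.smoothFieldAt hX hZ)

/-- An arbitrary extension X₀ is corrected by ∑ h_a F_a with h_a(x) = 0 and dh_a = -g(∇X₀, e_a) at
x. The value at x is unchanged and the derivative is cancelled, being horizontal. -/
theorem IsBiquard.exists_parallel_extension {x : M} (v : S.H x) :
    ∃ X : Π y : M, S.H y, (∀ᶠ y in 𝓝 x, S.SmoothAt X y) ∧ X x = v ∧
      D (fun y ↦ (X y : Tan n y)) x = 0 := by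
  let X₀ := C.extend v
  have hX₀ : ∀ᶠ y in 𝓝 x, S.SmoothAt X₀ y := C.eventually_smoothAt_extend v
  let F := fun a ↦ C.extend (S.e x a)
  have hF : ∀ a, ∀ᶠ y in 𝓝 x, S.SmoothAt (F a) y := fun a ↦ C.eventually_smoothAt_extend _
  have hFx : ∀ a, F a x = S.e x a := fun a ↦ C.extend_apply _
  let N : Tan n x →ₗ[ℝ] S.H x := C.hor x ∘ₗ (D (fun y ↦ (X₀ y : Tan n y)) x).toLinearMap
  have hN : ∀ u, (N u : Tan n x) = D (fun y ↦ (X₀ y : Tan n y)) x u := fun u ↦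
    C.coe_hor (hD.preserves_H x X₀ hX₀.self_of_nhds u)
  choose h hs h0 hd using fun a ↦ exists_smoothFunAt_differential_eq (n := n) x
    (-((S.g x).flip (S.e x a) ∘ₗ N))
  have hterm : ∀ a, ∀ᶠ y in 𝓝 x, SmoothFieldAt (fun y ↦ h a y • (F a y : Tan n y)) y := fun a ↦ by
    filter_upwards [hs a, hF a] with y h1 h2 using h1.smul h2
  have hsum : ∀ᶠ y in 𝓝 x, SmoothFieldAt (fun y ↦ ∑ a, h a y • (F a y : Tan n y)) y :=
    (Filter.eventually_all.2 hterm).mono fun y hy ↦ SmoothFieldAt.sum fun a _ ↦ hy a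
  have hcoe : (fun y ↦ ((X₀ y + ∑ a, h a y • F a y : S.H y) : Tan n y)) =
      fun y ↦ (X₀ y : Tan n y) + ∑ a, h a y • (F a y : Tan n y) := by
    ext1 y; simp
  refine ⟨fun y ↦ X₀ y + ∑ a, h a y • F a y, ?_, ?_, ?_⟩
  · filter_upwards [hX₀, hsum] with y h1 h2
    unfold PreStructure.SmoothAt
    rw [hcoe]
    exact SmoothFieldAt.add h1 h2
  · simp [X₀, h0, C.extend_apply]
  · rw [hcoe, D.D_add (SmoothFieldAt.diff hX₀.self_of_nhds) hsum.self_of_nhds.diff,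
      D.D_sum fun a _ ↦ (hterm a).self_of_nhds.diff]
    ext1 u
    have hs' : ∀ a, D (fun y ↦ h a y • (F a y : Tan n y)) x u =
        -(S.g x (N u) (S.e x a) • (S.e x a : Tan n x)) := fun a ↦ by
      rw [D.D_smul (hs a).self_of_nhds.diff (SmoothFieldAt.diff (hF a).self_of_nhds), h0, hd, hFx]
      simp
    have e2 := congrArg (Subtype.val) (S.sum_g_smul_e x (N u))
    rw [hN] at e2
    simp only [AddSubmonoidClass.coe_finsetSum, SetLike.val_smul] at e2
    simp [hs', e2]

end QCStructure

/-! ### Normal frames, the gradient and the sub-Laplacian -/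

namespace QCStructure

variable {n : ℕ} {M : Type*} [TopologicalSpace M] [ChartedSpace (Model n) M]
  [IsManifold (𝓡 (4 * n + 3)) ∞ M] {S : QCStructure n M} {C : S.Complement}
  {D : Connection n M} (hD : S.IsBiquard C D)

/-- A local horizontal frame around `p`, orthonormal and parallel at `p`. -/
structure IsNormalFrame (D : Connection n M) (p : M) (E : Fin (4 * n) → Π y : M, S.H y) :
    Prop where
  smooth : ∀ a, ∀ᶠ y in 𝓝 p, S.SmoothAt (E a) y
  apply_eq : ∀ a, E a p = S.e p a
  parallel : ∀ a, D (fun y ↦ (E a y : Tan n y)) p = 0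

include hD

theorem IsBiquard.exists_isNormalFrame (p : M) :
    ∃ E : Fin (4 * n) → Π y : M, S.H y, IsNormalFrame D p E := by
  choose E h1 h2 h3 using fun a ↦ hD.exists_parallel_extension (S.e p a)
  exact ⟨E, h1, h2, h3⟩

/-- G is the inverse Gram matrix of E. As ∇ is metric and E is orthonormal and parallel at p, the
Gram matrix equals the identity to first order there, and so does G. -/
theorem IsBiquard.exists_gram_inverse {p : M} {E : Fin (4 * n) → Π y : M, S.H y}
    (hE : IsNormalFrame D p E) :
    ∃ G : Fin (4 * n) → Fin (4 * n) → M → ℝ,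
      (∀ a b, SmoothFunAt (n := n) (G a b) p) ∧ (∀ a b, G a b p = if a = b then 1 else 0) ∧
      (∀ a b, differential (n := n) (G a b) p = 0) ∧
      ∀ᶠ y in 𝓝 p, ∀ B : LinearMap.BilinForm ℝ (S.H y),
        ∑ a, B (S.e y a) (S.e y a) = ∑ a, ∑ b, G a b y * B (E a y) (E b y) := by
  let K : M → Matrix (Fin (4 * n)) (Fin (4 * n)) ℝ :=
    fun y ↦ Matrix.of fun a b ↦ S.g y (E a y) (E b y)
  have hKs : ∀ a b, SmoothFunAt (n := n) (fun y ↦ K y a b) p := fun a b ↦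
    S.g_smooth p _ _ (hE.smooth a).self_of_nhds (hE.smooth b).self_of_nhds
  have hKp : K p = 1 := by
    ext a b
    simp [K, hE.apply_eq, g_e, Matrix.one_apply]
  have hK0 : (K p).det ≠ 0 := by simp [hKp]
  have hev : ∀ᶠ y in 𝓝 p, (K y).det ≠ 0 :=
    (ContMDiffAt.continuousAt (smoothFunAt_det hKs)).eventually_ne hK0
  have hGs : ∀ a b, SmoothFunAt (n := n) (fun y ↦ (K y)⁻¹ a b) p := fun a b ↦
    smoothFunAt_inv hKs hK0 a b
  have hdK : ∀ a b, differential (n := n) (fun y ↦ K y a b) p = 0 := fun a b ↦ by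
    ext1 v
    have h := hD.metric p _ _ (hE.smooth a).self_of_nhds (hE.smooth b).self_of_nhds v
    simpa [hE.parallel, K] using h
  refine ⟨fun a b y ↦ (K y)⁻¹ a b, hGs, fun a b ↦ ?_, fun a b ↦ ?_, ?_⟩
  · simp [hKp, Matrix.one_apply]
  -- Differentiating K K⁻¹ = 1 at p, where K = 1 and dK = 0.
  · have e : ∀ᶠ y in 𝓝 p, ∑ c, K y a c * (K y)⁻¹ c b = (1 : Matrix _ _ ℝ) a b := by
      filter_upwards [hev] with y hy
      rw [← Matrix.mul_nonsing_inv (K y) hy.isUnit, Matrix.mul_apply]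
    have h := differential_congr (n := n) e
    rw [differential_const, differential_sum fun c _ ↦ (hKs a c).diff.mul (hGs c b).diff] at h
    simpa [differential_mul (hKs a _).diff (hGs _ b).diff, hdK, hKp, Matrix.one_apply] using h
  · filter_upwards [hev] with y hy B
    exact S.sum_e_eq_sum_gram_inv y (fun a ↦ E a y) hy B

theorem IsBiquard.smoothAt_grad {f : M → ℝ} {p : M} (hf : SmoothFunAt (n := n) f p) :
    S.SmoothAt (S.grad f) p := by
  obtain ⟨E, hE⟩ := hD.exists_isNormalFrame p
  obtain ⟨G, hGs, -, -, hG⟩ := hD.exists_gram_inverse hE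
  have e : ∀ᶠ y in 𝓝 p, (S.grad f y : Tan n y) =
      ∑ a, ∑ b, (G a b y * differential (n := n) f y (E a y)) • (E b y : Tan n y) := by
    filter_upwards [hG] with y hy
    have h : S.grad f y = ∑ a, ∑ b, (G a b y * differential (n := n) f y (E a y)) • E b y := by
      refine S.eq_of_g_eq fun W ↦ ?_
      -- The trace formula for the bilinear form df ⊗ g(W, ·), whose trace is df(W).
      have h1 := hy (((differential f y).toLinearMap ∘ₗ (S.H y).subtype).smulRight (S.g y W))
      have h2 := S.sum_linear_mul_g y ((differential f y).toLinearMap ∘ₗ (S.H y).subtype) W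
      simp only [LinearMap.smulRight_apply, LinearMap.smul_apply, smul_eq_mul, LinearMap.comp_apply,
        Submodule.subtype_apply, ContinuousLinearMap.coe_coe] at h1 h2
      simp only [map_sum, map_smul, LinearMap.sum_apply, LinearMap.smul_apply, smul_eq_mul]
      rw [S.g_grad, ← h2]
      simp only [mul_comm (S.g y W _)]
      rw [h1]
      simp only [mul_assoc, S.g_symm y W]
    simpa using congrArg Subtype.val h
  refine SmoothFieldAt.congr (SmoothFieldAt.sum fun a _ ↦ SmoothFieldAt.sum fun b _ ↦ ?_) e
  exact ((hGs a b).mul (hf.differential_apply (hE.smooth a).self_of_nhds)).smul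
    (hE.smooth b).self_of_nhds

theorem IsBiquard.hess_eq_g {f : M → ℝ} {x : M} (hf : SmoothFunAt (n := n) f x) (v : Tan n x)
    (X : S.H x) :
    D.hess f x v X = S.g x (C.hor x (D (fun y ↦ (S.grad f y : Tan n y)) x v)) X := by
  have hX := (C.eventually_smoothAt_extend X).self_of_nhds
  have h1 := D.hess_apply hf (SmoothFieldAt.diff hX) v
  have h2 := hD.metric x _ _ (hD.smoothAt_grad hf) hX v
  simp only [S.g_grad, C.extend_apply, C.coe_hor (hD.preserves_H x _ hX v)] at h1 h2
  rw [h1, h2]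
  ring

theorem IsBiquard.differential_subLaplacian {f : M → ℝ}
    (hf : ∀ y, SmoothFunAt (n := n) f y) {p : M} {E : Fin (4 * n) → Π y : M, S.H y}
    (hE : IsNormalFrame D p E) (v : Tan n p) :
    differential (S.subLaplacian D f) p v =
      -∑ a, S.g p (C.hor p (D (fun y ↦
        (C.nab D (S.grad f) (fun z ↦ (E a z : Tan n z)) y : Tan n y)) p v)) (S.e p a) := by
  obtain ⟨G, hGs, hGp, hdG, hG⟩ := hD.exists_gram_inverse hE
  let N := fun a ↦ C.nab D (S.grad f) (fun z ↦ (E a z : Tan n z))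
  have hY : ∀ᶠ y in 𝓝 p, S.SmoothAt (S.grad f) y :=
    Filter.Eventually.of_forall fun y ↦ hD.smoothAt_grad (hf y)
  have hN : ∀ a, S.SmoothAt (N a) p := fun a ↦ hD.smoothAt_nab hY (hE.smooth a).self_of_nhds
  have e : ∀ᶠ y in 𝓝 p, S.subLaplacian D f y =
      -∑ a, ∑ b, G a b y * S.g y (N a y) (E b y) := by
    filter_upwards [hG] with y hy
    have h := hy (S.g y ∘ₗ C.hor y ∘ₗ
      (D (fun y ↦ (S.grad f y : Tan n y)) y).toLinearMap ∘ₗ (S.H y).subtype)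
    simp only [LinearMap.comp_apply, Submodule.subtype_apply, ContinuousLinearMap.coe_coe] at h
    simp only [subLaplacian, hD.hess_eq_g (hf y)]
    rw [h]
    rfl
  have hg : ∀ a b, DiffFunAt (n := n) (fun y ↦ S.g y (N a y) (E b y)) p := fun a b ↦
    (S.g_smooth p _ _ (hN a) (hE.smooth b).self_of_nhds).diff
  rw [differential_congr e, differential_neg,
    differential_sum fun a _ ↦ DiffFunAt.sum fun b _ ↦ (hGs a b).diff.mul (hg a b)]
  -- Since G = 1 and dG = 0 at p, only the diagonal terms survive, with the derivative on the second
  -- factor.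
  have h1 : ∀ a, differential (n := n) (fun y ↦ ∑ b, G a b y * S.g y (N a y) (E b y)) p =
      differential (fun y ↦ S.g y (N a y) (E a y)) p := fun a ↦ by
    rw [differential_sum fun b _ ↦ (hGs a b).diff.mul (hg a b)]
    simp [differential_mul (hGs a _).diff (hg a _), hdG, hGp]
  have h2 : ∀ a, differential (n := n) (fun y ↦ S.g y (N a y) (E a y)) p v =
      S.g p (C.hor p (D (fun y ↦ (N a y : Tan n y)) p v)) (S.e p a) := fun a ↦ by
    rw [hD.metric p _ _ (hN a) (hE.smooth a).self_of_nhds v]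
    simp [hE.parallel, hE.apply_eq]
  simp only [h1]
  simp [h2, N]

theorem IsBiquard.smoothFunAt_gradNormSq {f : M → ℝ} {x : M} (hf : SmoothFunAt (n := n) f x) :
    SmoothFunAt (n := n) (S.gradNormSq f) x :=
  S.g_smooth x _ _ (hD.smoothAt_grad hf) (hD.smoothAt_grad hf)

theorem IsBiquard.hess_gradNormSq {f : M → ℝ} (hf : ∀ y, SmoothFunAt (n := n) f y) {p : M}
    {E : Π y : M, S.H y} (hE : ∀ᶠ y in 𝓝 p, S.SmoothAt E y)
    (hDE : D (fun y ↦ (E y : Tan n y)) p = 0) :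
    D.hess (S.gradNormSq f) p (E p) (E p) =
      2 * S.g p (C.hor p (D (fun y ↦
          (C.nab D (S.grad f) (fun z ↦ (E z : Tan n z)) y : Tan n y)) p (E p))) (S.grad f p)
      + 2 * S.g p (C.nab D (S.grad f) (fun z ↦ (E z : Tan n z)) p)
          (C.nab D (S.grad f) (fun z ↦ (E z : Tan n z)) p) := by
  let N := C.nab D (S.grad f) (fun z ↦ (E z : Tan n z))
  have hY := fun y ↦ hD.smoothAt_grad (hf y)
  have hN : S.SmoothAt N p := hD.smoothAt_nab (Filter.Eventually.of_forall hY) hE.self_of_nhds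
  have e : (fun y ↦ differential (S.gradNormSq f) y (E y : Tan n y)) =
      fun y ↦ 2 * S.g y (N y) (S.grad f y) := by
    ext1 y
    have h := hD.metric y _ _ (hY y) (hY y) (E y)
    rw [S.g_symm y (S.grad f y)] at h
    rw [two_mul]
    exact h
  rw [D.hess_apply (hD.smoothFunAt_gradNormSq (hf p)) (SmoothFieldAt.diff hE.self_of_nhds), hDE, e,
    differential_mul (DiffFunAt.const _ _) (S.g_smooth p _ _ hN (hY p)).diff, differential_const]
  have h := hD.metric p _ _ hN (hY p) (E p)
  simp only [zero_apply, map_zero, sub_zero, smul_zero, add_zero,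
    smul_apply, h, smul_eq_mul]
  simp only [N, Complement.nab]
  ring

end QCStructure

/-! ### Quaternion relations in a local frame -/

section Frame

variable {n : ℕ} {M : Type*} [TopologicalSpace M] [ChartedSpace (Model n) M]
  [IsManifold (𝓡 (4 * n + 3)) ∞ M] {S : PreStructure n M} {U : Set M}
  {η : Fin 3 → Π x : M, Tan n x →ₗ[ℝ] ℝ} {I : Fin 3 → Π x : M, Module.End ℝ (S.H x)}

theorem PreStructure.IsFrame.anticomm_apply (hF : S.IsFrame U η I) {x : M} (hx : x ∈ U)
    (s t : Fin 3) (X : S.H x) :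
    I s x (I t x X) + I t x (I s x X) = (if s = t then (-2 : ℝ) else 0) • X := by
  have hq : ∀ s X, I s x (I s x X) = -X := fun s X ↦ LinearMap.congr_fun (hF.sq x hx s) X
  have h01 : ∀ X, I 0 x (I 1 x X) = I 2 x X := fun X ↦ LinearMap.congr_fun (hF.mul_01 x hx) X
  have h10 : ∀ X, I 1 x (I 0 x X) = -I 2 x X := fun X ↦ LinearMap.congr_fun (hF.mul_10 x hx) X
  have h02 : ∀ X, I 0 x (I 2 x X) = -I 1 x X := fun X ↦ by rw [← h01, hq]
  have h20 : ∀ X, I 2 x (I 0 x X) = I 1 x X := fun X ↦ by rw [← h01, h10, map_neg, h02, neg_neg]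
  have h21 : ∀ X, I 2 x (I 1 x X) = -I 0 x X := fun X ↦ by rw [← h01, hq, map_neg]
  have h12 : ∀ X, I 1 x (I 2 x X) = I 0 x X := fun X ↦ by rw [← h01, h10, h21, neg_neg]
  by_cases h : s = t
  · subst h
    rw [hq, if_pos rfl]
    module
  · rw [if_neg h, zero_smul]
    fin_cases s <;> fin_cases t <;> simp_all

end Frame

/-! ### The torsion on H and its parallelism -/

namespace QCStructure

variable {n : ℕ} {M : Type*} [TopologicalSpace M] [ChartedSpace (Model n) M]
  [IsManifold (𝓡 (4 * n + 3)) ∞ M] {S : QCStructure n M} {C : S.Complement}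
  {D : Connection n M} {U : Set M}
  {η : Fin 3 → Π x : M, Tan n x →ₗ[ℝ] ℝ} {I : Fin 3 → Π x : M, Module.End ℝ (S.H x)}

theorem exists_ne_zero (S : QCStructure n M) (hn : 1 ≤ n) (x : M) : ∃ X : S.H x, X ≠ 0 := by
  have : Nontrivial (S.H x) := by
    apply Module.nontrivial_of_finrank_pos (R := ℝ)
    rw [S.finrank_H]
    omega
  exact exists_ne 0

theorem g_I_left (hF : S.IsFrame U η I) {x : M} (hx : x ∈ U) (s : Fin 3) (X Z : S.H x) :
    S.g x (I s x X) Z = -S.g x X (I s x Z) := by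
  have h := hF.hermitian x hx s (I s x X) Z
  have h2 : I s x (I s x X) = -X := LinearMap.congr_fun (hF.sq x hx s) X
  rw [h2] at h
  simpa using h.symm

theorem Complement.eq_zero_of_forms_eq_zero (C : S.Complement) (hF : S.IsFrame U η I) {x : M}
    (hx : x ∈ U) {v : Tan n x} (hv : v ∈ C.V x) (h : ∀ s, η s x v = 0) : v = 0 :=
  Submodule.disjoint_def.1 (C.isCompl x).disjoint v ((hF.mem_iff x hx v).2 h) hv

theorem Complement.form_ver (C : S.Complement) (hF : S.IsFrame U η I) {x : M} (hx : x ∈ U)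
    (s : Fin 3) (v : Tan n x) : η s x (C.ver x v : Tan n x) = η s x v := by
  conv_rhs => rw [← C.coe_hor_add_coe_ver x v]
  rw [map_add, (hF.mem_iff x hx _).1 (C.hor x v).2 s, zero_add]

/-- The anticommutator with I_t annihilates every term but the t-th, leaving -2 c_t X. A nonzero X
exists because n ≥ 1. This yields injectivity of φ on V. -/
theorem linear_combination_eq_zero (hn : 1 ≤ n) (hF : S.IsFrame U η I) {x : M} (hx : x ∈ U)
    {c : Fin 3 → ℝ} (h : ∀ X : S.H x, ∑ s, c s • I s x X = 0) (t : Fin 3) : c t = 0 := by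
  obtain ⟨X, hX⟩ := S.exists_ne_zero hn x
  have h1 := h (I t x X)
  have h2 : I t x (∑ s, c s • I s x X) = 0 := by rw [h X, map_zero]
  have h3 : ∑ s, c s • (I s x (I t x X) + I t x (I s x X)) = 0 := by
    simp only [smul_add, Finset.sum_add_distrib, h1, zero_add]
    simpa using h2
  simp only [hF.anticomm_apply hx, smul_smul, ← Finset.sum_smul] at h3
  simpa using (smul_eq_zero.1 h3).resolve_right hX

/-- On horizontal fields the functions η_s(X) vanish near x, so dη_s(X, Z) = -η_s([X, Z]), and η_s
sees only the vertical part of the bracket. -/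
theorem IsBiquard.form_T (hD : S.IsBiquard C D) (hF : S.IsFrame U η I) {x : M} (hx : x ∈ U)
    (s : Fin 3) (X Z : S.H x) : η s x (D.T x X Z) = 2 * S.g x (I s x X) Z := by
  have hX := (C.eventually_smoothAt_extend X).self_of_nhds
  have hZ := (C.eventually_smoothAt_extend Z).self_of_nhds
  have h1 := hF.contact x hx s _ _ hX hZ
  have h2 := hD.torsion_H x _ _ hX hZ
  have hz : ∀ W : Π y : M, S.H y, differential (n := n) (fun y ↦ η s y (W y : Tan n y)) x = 0 := fun W ↦ by
    have e : ∀ᶠ y in 𝓝 x, η s y (W y : Tan n y) = 0 := by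
      filter_upwards [hF.isOpen.mem_nhds hx] with y hy using (hF.mem_iff y hy _).1 (W y).2 s
    rw [differential_congr e, differential_const]
  simp only [C.extend_apply] at h1 h2
  rw [h1, h2, map_neg, C.form_ver hF hx, extDerivOneForm, hz, hz]
  simp

theorem IsBiquard.T_mem_V (hD : S.IsBiquard C D) {x : M} (X Z : S.H x) :
    D.T x X Z ∈ C.V x := by
  have h := hD.torsion_H x _ _ (C.eventually_smoothAt_extend X).self_of_nhds
    (C.eventually_smoothAt_extend Z).self_of_nhds
  simp only [C.extend_apply] at h
  rw [h]
  exact neg_mem (Subtype.mem _)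

theorem IsBiquard.T_eq_sum (hD : S.IsBiquard C D) (hF : S.IsFrame U η I) {x : M} (hx : x ∈ U)
    {ξ : Fin 3 → Tan n x} (hξ : C.IsReebAt η x ξ) (X Z : S.H x) :
    D.T x X Z = ∑ s, (2 * S.g x (I s x X) Z) • ξ s := by
  rw [← sub_eq_zero]
  refine C.eq_zero_of_forms_eq_zero hF hx (sub_mem (hD.T_mem_V X Z)
    (sum_mem fun s _ ↦ Submodule.smul_mem _ _ (hξ.1 s))) fun s ↦ ?_
  simp [hD.form_T hF hx, hξ.2]

theorem Complement.hor_D_add (C : S.Complement) (D : Connection n M) {X Z : Π y : M, S.H y} {x : M}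
    (hX : S.SmoothAt X x) (hZ : S.SmoothAt Z x) (v : Tan n x) :
    C.hor x (D (fun y ↦ ((X y + Z y : S.H y) : Tan n y)) x v) =
      C.hor x (D (fun y ↦ (X y : Tan n y)) x v) + C.hor x (D (fun y ↦ (Z y : Tan n y)) x v) := by
  have h := congrArg (fun L : Tan n x →L[ℝ] Tan n x ↦ C.hor x (L v))
    (D.D_add (SmoothFieldAt.diff hX) (SmoothFieldAt.diff hZ))
  exact h.trans (map_add (C.hor x) _ _)

/-- The connection on `Q` is metric: in a frame, `∇I_s = ∑_t α_st I_t` with `α` skew. -/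
theorem IsBiquard.exists_skew (hD : S.IsBiquard C D) (hn : 1 ≤ n) (hF : S.IsFrame U η I) {x : M}
    (hx : x ∈ U) (v : Tan n x) :
    ∃ α : Fin 3 → Fin 3 → ℝ, (∀ s t, α s t = -α t s) ∧
      ∀ s, ∀ X : Π y : M, S.H y, S.SmoothAt X x →
        C.hor x (D (fun y ↦ (I s y (X y) : Tan n y)) x v) =
          ∑ t, α s t • I t x (X x) + I s x (C.hor x (D (fun y ↦ (X y : Tan n y)) x v)) := by
  classical
  have hU := hF.isOpen.mem_nhds hx
  have key : ∀ s, ∃ α : Fin 3 → ℝ, ∀ X : Π y : M, S.H y, S.SmoothAt X x →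
        C.hor x (D (fun y ↦ (I s y (X y) : Tan n y)) x v) =
          ∑ t, α t • I t x (X x) + I s x (C.hor x (D (fun y ↦ (X y : Tan n y)) x v)) := by
    intro s
    -- `quaternionic` concerns sections of Q on all of M, and the values of I outside U are
    -- arbitrary; extension by zero is harmless since only the germ at x matters.
    let σ : Π y : M, Module.End ℝ (S.H y) := fun y ↦ if y ∈ U then I s y else 0
    have hσ : ∀ y ∈ U, σ y = I s y := fun y hy ↦ if_pos hy
    have hσe : ∀ X : Π y : M, S.H y,
        ∀ᶠ y in 𝓝 x, (σ y (X y) : Tan n y) = I s y (X y) := fun X ↦ by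
      filter_upwards [hU] with y hy
      rw [hσ y hy]
    have hσQ : ∀ y, σ y ∈ S.Q y := fun y ↦ by
      by_cases hy : y ∈ U
      · rw [hσ y hy, hF.span y hy]
        exact Submodule.subset_span ⟨s, rfl⟩
      · simp [σ, hy]
    have hσs : S.SmoothEndAt σ x := fun X hX ↦
      SmoothFieldAt.congr (hF.smooth_end s x hx X hX) (hσe X)
    obtain ⟨τ, hτ, h⟩ := hD.quaternionic x σ hσQ hσs v
    rw [hF.span x hx, Submodule.mem_span_range_iff_exists_fun] at hτ
    obtain ⟨α, rfl⟩ := hτ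
    refine ⟨α, fun X hX ↦ ?_⟩
    have h1 := h X hX
    rw [D.D_congr (SmoothFieldAt.diff (hσs X hX))
      (SmoothFieldAt.diff (hF.smooth_end s x hx X hX)) (hσe X), hσ x hx] at h1
    simpa using h1
  choose α hα using key
  refine ⟨α, fun s t ↦ ?_, hα⟩
  obtain ⟨w, hw⟩ := S.exists_ne_zero hn x
  obtain ⟨X, hXs, hXw, hDX⟩ := hD.exists_parallel_extension w
  have hX := hXs.self_of_nhds
  have hIX : ∀ s, S.SmoothAt (fun y ↦ I s y (X y)) x := fun s ↦ hF.smooth_end s x hx X hX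
  have hIIX : ∀ s t, S.SmoothAt (fun y ↦ I s y (I t y (X y))) x := fun s t ↦
    hF.smooth_end s x hx _ (hIX t)
  -- Differentiating I_s I_t + I_t I_s = -2 δ_st along v, on a field parallel at x, gives -2 α_st -
  -- 2 α_ts = 0.
  have e : ∀ᶠ y in 𝓝 x, ((I s y (I t y (X y)) + I t y (I s y (X y)) : S.H y) : Tan n y) =
      (if s = t then (-2 : ℝ) else 0) • (X y : Tan n y) := by
    filter_upwards [hU] with y hy
    rw [hF.anticomm_apply hy]
    rfl
  have d1 : SmoothFieldAt (fun y ↦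
      ((I s y (I t y (X y)) + I t y (I s y (X y)) : S.H y) : Tan n y)) x :=
    SmoothFieldAt.add (hIIX s t) (hIIX t s)
  have h1 := congrArg (fun L : Tan n x →L[ℝ] Tan n x ↦ C.hor x (L v))
    (D.D_congr d1.diff ((DiffFunAt.const _ x).smul (SmoothFieldAt.diff hX)) e)
  simp only [C.hor_D_add D (hIIX s t) (hIIX t s),
    D.D_smul (DiffFunAt.const _ x) (SmoothFieldAt.diff hX), hDX, differential_const] at h1
  rw [hα s _ (hIX t), hα t _ (hIX s), hα s _ hX, hα t _ hX, hDX, hXw] at h1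
  have h2 : ∑ u, α s u • (I u x (I t x w) + I t x (I u x w)) +
      ∑ u, α t u • (I u x (I s x w) + I s x (I u x w)) = 0 := by
    simp only [smul_add, Finset.sum_add_distrib]
    simp only [zero_apply, map_zero, add_zero, map_sum, map_smul, smul_zero, zero_smul] at h1
    rw [← h1]
    abel
  simp only [hF.anticomm_apply hx, smul_smul, ← Finset.sum_smul, ← add_smul] at h2
  have h3 := (smul_eq_zero.1 h2).resolve_right hw
  simp only [mul_ite, mul_zero, Finset.sum_ite_eq', Finset.mem_univ, if_true] at h3
  linarith

theorem IsBiquard.T_field (hD : S.IsBiquard C D) {X Z : Π y : M, S.H y} {x : M}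
    (hX : ∀ᶠ y in 𝓝 x, S.SmoothAt X y) (hZ : ∀ᶠ y in 𝓝 x, S.SmoothAt Z y) :
    ∀ᶠ y in 𝓝 x, D.T y (X y) (Z y) = (C.ver y (-bracket (fun y ↦ (X y : Tan n y))
      (fun y ↦ (Z y : Tan n y)) y) : Tan n y) := by
  filter_upwards [hX, hZ] with y h1 h2
  rw [hD.torsion_H y X Z h1 h2, map_neg]
  rfl

theorem Complement.smoothFieldAt_ver (C : S.Complement) {X : Π y : M, Tan n y} {x : M}
    (hX : SmoothFieldAt X x) : SmoothFieldAt (fun y ↦ (C.ver y (X y) : Tan n y)) x := by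
  have h : (fun y ↦ (C.ver y (X y) : Tan n y)) = fun y ↦ X y - (C.hor y (X y) : Tan n y) := by
    ext1 y
    rw [eq_sub_iff_add_eq, add_comm, C.coe_hor_add_coe_ver]
  rw [h]
  exact hX.sub (C.smoothAt_hor hX)

theorem IsBiquard.smoothFieldAt_T (hD : S.IsBiquard C D) {X Z : Π y : M, S.H y} {x : M}
    (hX : ∀ᶠ y in 𝓝 x, S.SmoothAt X y) (hZ : ∀ᶠ y in 𝓝 x, S.SmoothAt Z y) :
    SmoothFieldAt (fun y ↦ D.T y (X y) (Z y)) x :=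
  (C.smoothFieldAt_ver (SmoothFieldAt.bracket hX.self_of_nhds hZ.self_of_nhds).neg).congr
    (hD.T_field hX hZ)

/-- The tensor ∑ g(I_s ·, ·) I_s is parallel: its derivative has the terms α_st g(I_s X, Z) I_t W
and α_st g(I_t X, Z) I_s W, which cancel after exchanging s and t because α is skew. -/
theorem IsBiquard.hor_D_sum_eq_zero (hD : S.IsBiquard C D) (hn : 1 ≤ n) (hF : S.IsFrame U η I)
    {x : M} (hx : x ∈ U) {X Z W : Π y : M, S.H y}
    (hX : S.SmoothAt X x) (hZ : S.SmoothAt Z x) (hW : S.SmoothAt W x)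
    (hDX : D (fun y ↦ (X y : Tan n y)) x = 0) (hDZ : D (fun y ↦ (Z y : Tan n y)) x = 0)
    (hDW : D (fun y ↦ (W y : Tan n y)) x = 0) (v : Tan n x) :
    C.hor x (D (fun y ↦ ∑ s, (2 * S.g y (I s y (X y)) (Z y)) • (I s y (W y) : Tan n y)) x v) =
      0 := by
  obtain ⟨α, hα, hI⟩ := hD.exists_skew hn hF hx v
  have hIX : ∀ s, S.SmoothAt (fun y ↦ I s y (X y)) x := fun s ↦ hF.smooth_end s x hx X hX
  have hIW : ∀ s, S.SmoothAt (fun y ↦ I s y (W y)) x := fun s ↦ hF.smooth_end s x hx W hW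
  have hg : ∀ s, SmoothFunAt (n := n) (fun y ↦ 2 * S.g y (I s y (X y)) (Z y)) x := fun s ↦
    (SmoothFunAt.const _ _).mul (S.g_smooth x _ _ (hIX s) hZ)
  have hterm : ∀ s, SmoothFieldAt (fun y ↦
      (2 * S.g y (I s y (X y)) (Z y)) • (I s y (W y) : Tan n y)) x := fun s ↦ (hg s).smul (hIW s)
  rw [D.D_sum fun s _ ↦ (hterm s).diff]
  have hd : ∀ s, differential (n := n) (fun y ↦ 2 * S.g y (I s y (X y)) (Z y)) x v =
      2 * S.g x (∑ t, α s t • I t x (X x)) (Z x) := fun s ↦ by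
    rw [differential_mul (DiffFunAt.const _ _) (S.g_smooth x _ _ (hIX s) hZ).diff,
      differential_const]
    have h := hD.metric x _ _ (hIX s) hZ v
    rw [hI s X hX, hDX, hDZ] at h
    simp only [zero_apply, map_zero, add_zero] at h
    simp only [smul_zero, add_zero, smul_apply, h, smul_eq_mul]
  have hD' : ∀ s, C.hor x (D (fun y ↦
      (2 * S.g y (I s y (X y)) (Z y)) • (I s y (W y) : Tan n y)) x v) =
        (2 * S.g x (I s x (X x)) (Z x)) • (∑ t, α s t • I t x (W x)) +
          (2 * S.g x (∑ t, α s t • I t x (X x)) (Z x)) • I s x (W x) := fun s ↦ by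
    rw [D.D_smul (hg s).diff (SmoothFieldAt.diff (hIW s)), hd, map_add, map_smul, map_smul,
      hI s W hW, hDW, C.hor_coe]
    simp only [zero_apply, map_zero, add_zero]
  have a0 : α 0 0 = 0 := by linarith [hα 0 0]
  have a1 : α 1 1 = 0 := by linarith [hα 1 1]
  have a2 : α 2 2 = 0 := by linarith [hα 2 2]
  simp only [Fin.sum_univ_three, add_apply, map_add] at hD' ⊢
  simp only [hD', a0, a1, a2, hα 1 0, hα 2 0, hα 2 1, map_smul, LinearMap.add_apply,
    LinearMap.smul_apply, smul_eq_mul]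
  generalize I 0 x (W x) = w0, I 1 x (W x) = w1, I 2 x (W x) = w2
  module

/-- φ carries T(X, Z) to 2 ∑ g(I_s X, Z) I_s, which has zero derivative when X and Z are parallel at
x. As φ is parallel and injective on V, the derivative of T(X, Z) vanishes. -/
theorem IsBiquard.D_T_eq_zero (hD : S.IsBiquard C D) (hn : 1 ≤ n) (hF : S.IsFrame U η I) {x : M}
    (hx : x ∈ U) {X Z : Π y : M, S.H y}
    (hX : ∀ᶠ y in 𝓝 x, S.SmoothAt X y) (hZ : ∀ᶠ y in 𝓝 x, S.SmoothAt Z y)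
    (hDX : D (fun y ↦ (X y : Tan n y)) x = 0) (hDZ : D (fun y ↦ (Z y : Tan n y)) x = 0) :
    D (fun y ↦ D.T y (X y) (Z y)) x = 0 := by
  ext1 v
  rw [zero_apply]
  let ξ : Π y : M, C.V y := fun y ↦
    C.ver y (-bracket (fun y ↦ (X y : Tan n y)) (fun y ↦ (Z y : Tan n y)) y)
  have hξ : SmoothFieldAt (fun y ↦ (ξ y : Tan n y)) x :=
    C.smoothFieldAt_ver (SmoothFieldAt.bracket hX.self_of_nhds hZ.self_of_nhds).neg
  have hξT : ∀ᶠ y in 𝓝 x, D.T y (X y) (Z y) = ξ y := hD.T_field hX hZ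
  clear_value ξ
  rw [D.D_congr (hD.smoothFieldAt_T hX hZ).diff hξ.diff hξT]
  refine C.eq_zero_of_forms_eq_zero hF hx (hD.preserves_V x ξ hξ v) ?_
  refine linear_combination_eq_zero (c := fun s ↦ η s x (D (fun y ↦ (ξ y : Tan n y)) x v))
    hn hF hx fun w ↦ ?_
  obtain ⟨W, hWs, rfl, hDW⟩ := hD.exists_parallel_extension w
  have hW := hWs.self_of_nhds
  have h1 := hD.phi_parallel U η I hF x hx ξ W hξ hW v
  rw [hDW, zero_apply, map_zero, map_zero, add_zero] at h1
  have h2 : S.phi η I x (D (fun y ↦ (ξ y : Tan n y)) x v) (W x) =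
      ∑ s, η s x (D (fun y ↦ (ξ y : Tan n y)) x v) • I s x (W x) := by
    simp [phi]
  have e : ∀ᶠ y in 𝓝 x, (S.phi η I y (ξ y) (W y) : Tan n y) =
      ∑ s, (2 * S.g y (I s y (X y)) (Z y)) • (I s y (W y) : Tan n y) := by
    filter_upwards [hξT, hF.isOpen.mem_nhds hx] with y hy hyU
    have : ∀ s, η s y (ξ y) = 2 * S.g y (I s y (X y)) (Z y) := fun s ↦ by
      rw [← hD.form_T hF hyU, hy]
    simp [phi, this]
  have hs : SmoothFieldAt (fun y ↦
      ∑ s, (2 * S.g y (I s y (X y)) (Z y)) • (I s y (W y) : Tan n y)) x :=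
    SmoothFieldAt.sum fun s _ ↦ SmoothFunAt.smul ((SmoothFunAt.const _ _).mul (S.g_smooth x _ _
      (hF.smooth_end s x hx X hX.self_of_nhds) hZ.self_of_nhds)) (hF.smooth_end s x hx W hW)
  rw [← h2, ← h1, D.D_congr (hs.congr e).diff hs.diff e,
    hD.hor_D_sum_eq_zero hn hF hx hX.self_of_nhds hZ.self_of_nhds hW hDX hDZ hDW v]

end QCStructure

/-! ### Commuting derivatives and the torsion traces -/

namespace QCStructure

variable {n : ℕ} {M : Type*} [TopologicalSpace M] [ChartedSpace (Model n) M]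
  [IsManifold (𝓡 (4 * n + 3)) ∞ M] {S : QCStructure n M} {C : S.Complement}
  {D : Connection n M} {U : Set M}
  {η : Fin 3 → Π x : M, Tan n x →ₗ[ℝ] ℝ} {I : Fin 3 → Π x : M, Module.End ℝ (S.H x)}

/-- Commutation of second covariant derivatives of the gradient. -/
theorem IsBiquard.g_nab_nab_grad (hD : S.IsBiquard C D) (hn : 1 ≤ n) (hF : S.IsFrame U η I)
    {p : M} (hp : p ∈ U) {f : M → ℝ} (hf : ∀ y, SmoothFunAt (n := n) f y)
    {E B : Π y : M, S.H y} (hE : ∀ᶠ y in 𝓝 p, S.SmoothAt E y)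
    (hB : ∀ᶠ y in 𝓝 p, S.SmoothAt B y) (hDE : D (fun y ↦ (E y : Tan n y)) p = 0)
    (hDB : D (fun y ↦ (B y : Tan n y)) p = 0) (hBp : B p = S.grad f p) :
    S.g p (C.hor p (D (fun y ↦
        (C.nab D (S.grad f) (fun z ↦ (E z : Tan n z)) y : Tan n y)) p (E p))) (S.grad f p) =
      S.g p (C.hor p (D (fun y ↦
        (C.nab D (S.grad f) (fun z ↦ (E z : Tan n z)) y : Tan n y)) p (S.grad f p))) (E p)
      + C.gExt p (D.R p (E p) (S.grad f p) (S.grad f p)) (E p)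
      - D.hess f p (D.T p (E p) (S.grad f p)) (E p)
      - D.hess f p (E p) (D.T p (E p) (S.grad f p)) := by
  have hY : ∀ y, S.SmoothAt (S.grad f) y := fun y ↦ hD.smoothAt_grad (hf y)
  have hY' : ∀ᶠ y in 𝓝 p, SmoothFieldAt (fun y ↦ (S.grad f y : Tan n y)) y :=
    Filter.Eventually.of_forall hY
  let N := C.nab D (S.grad f) (fun z ↦ (E z : Tan n z))
  let L := C.nab D (S.grad f) (fun z ↦ (B z : Tan n z))
  have hN : S.SmoothAt N p := hD.smoothAt_nab hY' hE.self_of_nhds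
  have hL : S.SmoothAt L p := hD.smoothAt_nab hY' hB.self_of_nhds
  have hT := hD.smoothFieldAt_T hE hB
  -- Symmetry of the Hessian up to torsion, as an identity of functions, to be differentiated along
  -- E at p.
  have e : (fun y ↦ S.g y (N y) (B y)) =
      fun y ↦ S.g y (L y) (E y) - differential f y (D.T y (E y) (B y)) := by
    ext1 y
    have h := D.hess_sub_hess_swap (x := y) (Filter.Eventually.of_forall hf) (E y) (B y)
    rw [hD.hess_eq_g (hf y), hD.hess_eq_g (hf y)] at h
    simp only [N, L, Complement.nab]
    linarith
  have h1 := hD.metric p N B hN hB.self_of_nhds (E p)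
  have h2 := hD.metric p L E hL hE.self_of_nhds (E p)
  have h3 := D.hess_apply (hf p) hT.diff (E p : Tan n p)
  rw [e, differential_sub (S.g_smooth p _ _ hL hE.self_of_nhds).diff
    ((hf p).differential_apply hT).diff, sub_apply, h2, hDE, hDB] at h1
  rw [hD.D_T_eq_zero hn hF hp hE hB hDE hDB] at h3
  have h4 := hD.isSmooth.R_apply hE hB hY'
  have h5 := D.T_apply (SmoothFieldAt.diff hE.self_of_nhds) (SmoothFieldAt.diff hB.self_of_nhds)
  rw [hDE, hDB] at h5
  simp only [zero_apply, map_zero, add_zero, sub_zero, zero_sub] at h1 h3 h5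
  have eN : ∀ Z : Π y : M, S.H y,
      (fun y ↦ (C.nab D (S.grad f) (fun z ↦ (Z z : Tan n z)) y : Tan n y)) =
        fun y ↦ D (fun y ↦ (S.grad f y : Tan n y)) y (Z y) := fun Z ↦ by
    ext1 y
    exact hD.coe_nab (hY y)
  -- E and B are parallel at p, so their bracket there is minus the torsion; hence the term ∇_[E, B]
  -- of the curvature becomes a Hessian term.
  have h6 : bracket (fun y ↦ (E y : Tan n y)) (fun y ↦ (B y : Tan n y)) p =
      -D.T p (E p) (B p) := by rw [h5, neg_neg]
  rw [Connection.curv, h6, map_neg, ← eN, ← eN] at h4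
  have h7 := congrArg (fun w ↦ S.g p (C.hor p w) (E p)) h4
  simp only [map_sub, map_neg, LinearMap.sub_apply, LinearMap.neg_apply] at h7
  have h8 := hD.hess_eq_g (hf p) (D.T p (E p) (B p)) (E p)
  simp only [N, L] at h1
  simp only [Complement.gExt]
  rw [hBp] at h1 h3 h7 h8
  linarith

/-- T(e_a, X) = 2 ∑ g(I_s e_a, X) ξ_s; moving the skew I_s onto X gives the factor -2, and the sum
over a reassembles I_s X. -/
theorem IsBiquard.sum_hess_T_left (hD : S.IsBiquard C D) (hF : S.IsFrame U η I) {p : M}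
    (hp : p ∈ U) {f : M → ℝ} (hf : SmoothFunAt (n := n) f p) {ξ : Fin 3 → Tan n p}
    (hξ : C.IsReebAt η p ξ) (X : S.H p) :
    ∑ a, D.hess f p (D.T p (S.e p a) X) (S.e p a) = -2 * ∑ s, D.hess f p (ξ s) (I s p X) := by
  simp only [D.hess_eq_hessBilin hf, hD.T_eq_sum hF hp hξ, map_sum, map_smul, smul_eq_mul]
  rw [Finset.sum_comm, Finset.mul_sum]
  refine Finset.sum_congr rfl fun s _ ↦ ?_
  let L : S.H p →ₗ[ℝ] ℝ :=
    { toFun := fun Z ↦ D.hessBilin hf Z (ξ s)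
      map_add' := by simp
      map_smul' := by simp }
  have h : ∑ a, S.g p (I s p X) (S.e p a) * D.hessBilin hf (S.e p a) (ξ s) =
      D.hessBilin hf (I s p X) (ξ s) := S.sum_linear_mul_g p L (I s p X)
  rw [← h, Finset.mul_sum]
  refine Finset.sum_congr rfl fun a _ ↦ ?_
  rw [g_I_left hF hp, S.g_symm p (S.e p a)]
  ring

theorem IsBiquard.sum_hess_T_right (hD : S.IsBiquard C D) (hF : S.IsFrame U η I) {p : M}
    (hp : p ∈ U) {f : M → ℝ} (hf : SmoothFunAt (n := n) f p) {ξ : Fin 3 → Tan n p}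
    (hξ : C.IsReebAt η p ξ) (X : S.H p) :
    ∑ a, D.hess f p (S.e p a) (D.T p (S.e p a) X) = -2 * ∑ s, D.hess f p (I s p X) (ξ s) := by
  simp only [D.hess_eq_hessBilin hf, hD.T_eq_sum hF hp hξ, map_sum, map_smul, smul_eq_mul,
    sum_apply, smul_apply]
  rw [Finset.sum_comm, Finset.mul_sum]
  refine Finset.sum_congr rfl fun s _ ↦ ?_
  have h := S.sum_linear_mul_g p
    ((D.hessBilin hf (ξ s)).toLinearMap ∘ₗ (S.H p).subtype) (I s p X)
  simp only [LinearMap.comp_apply, Submodule.subtype_apply, ContinuousLinearMap.coe_coe] at h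
  rw [← h, Finset.mul_sum]
  refine Finset.sum_congr rfl fun a _ ↦ ?_
  rw [g_I_left hF hp, S.g_symm p (S.e p a)]
  ring

/-- T(ξ, X) is horizontal, so df of it is its product with the gradient. -/
theorem IsBiquard.hess_horizontal_vertical (hD : S.IsBiquard C D) {p : M} {f : M → ℝ}
    (hf : ∀ᶠ y in 𝓝 p, SmoothFunAt (n := n) f y) {ξ : Tan n p} (hξ : ξ ∈ C.V p) (X : S.H p) :
    D.hess f p X ξ = D.hess f p ξ X + C.gExt p (D.T p ξ X) (S.grad f p) := by
  have h := D.hess_sub_hess_swap hf ξ X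
  have h2 := S.g_grad f p (C.hor p (D.T p ξ X))
  rw [C.coe_hor (hD.torsion_V p ⟨ξ, hξ⟩ X), S.g_symm] at h2
  rw [Complement.gExt, h2]
  linarith

end QCStructure

end QC

end

theorem theorem3p1 {n : ℕ} (hn : 1 ≤ n) {M : Type*} [TopologicalSpace M]
    [ChartedSpace (QC.Model n) M] [IsManifold (𝓡 (4 * n + 3)) ∞ M]
    (S : QC.QCStructure n M) (C : S.Complement) (D : QC.Connection n M) (hD : S.IsBiquard C D)
    (f : M → ℝ) (hf : ContMDiff (𝓡 (4 * n + 3)) 𝓘(ℝ, ℝ) ∞ f)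
    (U : Set M) (η : Fin 3 → Π x : M, QC.Tan n x →ₗ[ℝ] ℝ)
    (I : Fin 3 → Π x : M, Module.End ℝ (S.H x)) (hF : S.IsFrame U η I)
    (p : M) (hp : p ∈ U) (ξ : Fin 3 → QC.Tan n p) (hξ : C.IsReebAt η p ξ) :
    -(1 / 2) * S.subLaplacian D (S.gradNormSq f) p =
      S.hessNormSq D f p
        - S.g p (S.grad (S.subLaplacian D f) p) (S.grad f p)
        + C.Ric D p (S.grad f p) (S.grad f p)
        + 2 * ∑ s, C.gExt p (D.T p (ξ s) (I s p (S.grad f p))) (S.grad f p)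
        + 4 * ∑ s, D.hess f p (ξ s) (I s p (S.grad f p)) := by
  have hf' : ∀ y, QC.SmoothFunAt (n := n) f y := fun y ↦ hf y
  obtain ⟨E, hE⟩ := hD.exists_isNormalFrame p
  -- The gradient need not be parallel at p; B shares its value there, and T(E_a, B) then has zero
  -- derivative at p.
  obtain ⟨B, hB, hBp, hDB⟩ := hD.exists_parallel_extension (S.grad f p)
  have h1 : S.hessNormSq D f p = ∑ a,
      S.g p (C.nab D (S.grad f) (fun z ↦ (E a z : QC.Tan n z)) p)
        (C.nab D (S.grad f) (fun z ↦ (E a z : QC.Tan n z)) p) := by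
    refine Finset.sum_congr rfl fun a _ ↦ ?_
    rw [← S.sum_g_mul_g]
    refine Finset.sum_congr rfl fun b _ ↦ ?_
    rw [hD.hess_eq_g (hf' p), sq, QC.QCStructure.Complement.nab, hE.apply_eq]
  have h2 := hD.differential_subLaplacian hf' hE (S.grad f p)
  rw [← S.g_grad] at h2
  have h3 := fun a ↦ hD.hess_gradNormSq hf' (hE.smooth a) (hE.parallel a)
  have h4 := fun a ↦ hD.g_nab_nab_grad hn hF hp hf' (hE.smooth a) hB (hE.parallel a) hDB hBp
  have h5 := hD.sum_hess_T_left hF hp (hf' p) hξ (S.grad f p)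
  have h6 := hD.sum_hess_T_right hF hp (hf' p) hξ (S.grad f p)
  -- Swapping the arguments of ∇²f(I_s ∇f, ξ_s) creates the torsion terms of the formula and a
  -- second copy of ∑ ∇²f(ξ_s, I_s ∇f).
  simp only [hD.hess_horizontal_vertical (Filter.Eventually.of_forall hf') (hξ.1 _),
    Finset.sum_add_distrib] at h6
  have h7 := Finset.sum_congr rfl fun a (_ : a ∈ Finset.univ) ↦ (h3 a).trans (by rw [h4 a])
  simp only [hE.apply_eq, Finset.sum_add_distrib, ← Finset.mul_sum, Finset.sum_sub_distrib] at h7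
  rw [h5, h6, ← h1] at h7
  rw [QC.QCStructure.subLaplacian, h7, h2]
  simp only [QC.QCStructure.Complement.Ric]
  ring
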